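/- Let $K$ be an algebraically closed field of characteristic $0$, let $N\ge 5$, and let $S\subset\mathbb{P}^N$ be a surface over $K$, i.e. an irreducible Zariski closed subset of dimension $2$. For a non-singular point $p=[x]$ of a projective variety $X\subset\mathbb{P}^N$ let $\mathbb{T}_pX$ be its embedded tangent space, let $T_pX\cong\hat{\mathbb{T}}_pX/\langle x\rangle$ be its tangent space (where $\hat{\mathbb{T}}_pX\subset K^{N+1}$ is the linear subspace with projectivization $\mathbb{T}_pX$), and let $II_p\colon T_pX\times T_pX\to K^{N+1}/\hat{\mathbb{T}}_pX$ be the second fundamental form, i.e. the differential of the Gauss map $q\mapsto\mathbb{T}_qX$. The second osculating space of $X$ at $p$ is the intersection of all hyperplanes whose equation, restricted to $X$, vanishes at $p$ to order at least $3$ (equivalently, the projective span of $p$ and of all first and second derivatives at $p$ of a local parametrization of $X$). Two tangent directions $[v],[w]\in\mathbb{P}(T_pX)$ are conjugate if $II_p(v,w)=0$; a direction conjugate to itself is called asymptotic. A property holds at a general point of $S$ if it holds at all points of some non-empty Zariski open subset of $S$ consisting of non-singular points. Then the following are equivalent: (i) $S$ is a $\Phi$ surface, i.e. at a general point $p$ of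 $S$ the second osculating space has dimension $4$; (ii) at a general point $p$ of $S$ there is exactly one unordered pair of conjugate directions, where the two directions of the pair may be distinct or may coincide (in the latter case the pair is one asymptotic direction); (iii) the Zariski closure $V\subset\mathbb{P}^N$ of the union of the tangent planes $\mathbb{T}_pS$ at the non-singular points $p$ of $S$ is a variety (irreducible) of dimension $4$, and its embedded tangent space is fixed along those planes: for every non-singular point $p$ of $S$ and all $q,q'\in\mathbb{T}_pS$ that are non-singular points of $V$, $\mathbb{T}_qV=\mathbb{T}_{q'}V$. -/

import Mathlib

namespace ProjSurf

noncomputable section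

open MvPolynomial

variable {K : Type*} [Field K] {N : ℕ}

/-- The projective space `ℙ^N` over `K`, as the set of lines in `K^(N+1)`. -/
abbrev PSpace (K : Type*) [Field K] (N : ℕ) : Type _ :=
  Projectivization K (Fin (N + 1) → K)

/-- The punctured affine cone over a subset of `ℙ^N`. -/
def affineCone (A : Set (PSpace K N)) : Set (Fin (N + 1) → K) :=
  {x | ∃ h : x ≠ 0, Projectivization.mk K x h ∈ A}

/-- The ideal `I(A)` of all polynomials vanishing on `A`, that is, on its affine cone. -/
def idealOf (A : Set (PSpace K N)) : Ideal (MvPolynomial (Fin (N + 1)) K) :=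
  vanishingIdeal K (affineCone A)

/-- The homogeneous coordinate ring of `A`. -/
abbrev CoordRing (A : Set (PSpace K N)) : Type _ :=
  MvPolynomial (Fin (N + 1)) K ⧸ idealOf A

/-- Zariski closed subsets of `ℙ^N`: common zero loci of homogeneous polynomials. -/
def IsZariskiClosed (A : Set (PSpace K N)) : Prop :=
  ∃ F : Set (MvPolynomial (Fin (N + 1)) K), (∀ f ∈ F, ∃ n, f.IsHomogeneous n) ∧
    A = {p | ∀ f ∈ F, eval p.rep f = 0}

/-- The Zariski closure of `A`: the points where all polynomials vanishing on `A` vanish. -/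
def zariskiClosure (A : Set (PSpace K N)) : Set (PSpace K N) :=
  {p | ∀ f ∈ idealOf A, eval p.rep f = 0}

/-- A projective variety: an irreducible (in particular non-empty) closed subset of `ℙ^N`. -/
structure IsProjVariety (X : Set (PSpace K N)) : Prop where
  closed : IsZariskiClosed X
  prime : (idealOf X).IsPrime

/-- `X` has dimension `d`: its homogeneous coordinate ring, which is the coordinate ring of the
`(d+1)`-dimensional affine cone, has transcendence degree `d + 1` over `K`. -/
def HasDim (X : Set (PSpace K N)) (d : ℕ) : Prop :=
  Algebra.trdeg K (CoordRing X) = ((d + 1 : ℕ) : Cardinal)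

/-- The first differential `df_x(v) = ∑ᵢ ∂ᵢf(x) vᵢ`. -/
def diff1 (f : MvPolynomial (Fin (N + 1)) K) (x v : Fin (N + 1) → K) : K :=
  ∑ i, eval x (pderiv i f) * v i

/-- The second differential `d²f_x(v, w) = ∑ᵢⱼ ∂ᵢ∂ⱼf(x) vᵢ wⱼ`. -/
def diff2 (f : MvPolynomial (Fin (N + 1)) K) (x v w : Fin (N + 1) → K) : K :=
  ∑ i, ∑ j, eval x (pderiv i (pderiv j f)) * v i * w j

/-- The linear subspace of `K^(N+1)` whose projectivization is the embedded (Zariski) tangent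
space to `X` at `p`. -/
def tangentSpace (X : Set (PSpace K N)) (p : PSpace K N) :
    Submodule K (Fin (N + 1) → K) where
  carrier := {v | ∀ f ∈ idealOf X, diff1 f p.rep v = 0}
  zero_mem' := by intro f _; simp [diff1]
  add_mem' := by
    intro v w hv hw f hf
    have h1 := hv f hf
    have h2 := hw f hf
    simp only [diff1] at h1 h2 ⊢
    simp [mul_add, Finset.sum_add_distrib, h1, h2]
  smul_mem' := by
    intro c v hv f hf
    have h1 := hv f hf
    simp only [diff1] at h1 ⊢
    have : ∀ i, eval p.rep (pderiv i f) * (c • v) i = c * (eval p.rep (pderiv i f) * v i) := by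
      intro i; simp [mul_left_comm]
    rw [Finset.sum_congr rfl fun i _ => this i, ← Finset.mul_sum, h1, mul_zero]

/-- `p` is a non-singular point of the variety `X`: it lies on `X` and the embedded tangent space
there has the dimension of `X` (both dimensions are increased by one here, by passing to cones). -/
def IsNonsingularPoint (X : Set (PSpace K N)) (p : PSpace K N) : Prop :=
  p ∈ X ∧ Module.rank K (tangentSpace X p) = Algebra.trdeg K (CoordRing X)

/-- A property holds at a general point of `X`: it holds on a non-empty Zariski open subset. -/
def AtGeneralPoint (X : Set (PSpace K N)) (P : PSpace K N → Prop) : Prop :=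
  ∃ U : Set (PSpace K N), IsZariskiClosed Uᶜ ∧ (X ∩ U).Nonempty ∧ ∀ p ∈ X ∩ U, P p

/-- The linear form `∑ᵢ aᵢ Xᵢ`. -/
def linForm (a : Fin (N + 1) → K) : MvPolynomial (Fin (N + 1)) K :=
  ∑ i, C (a i) * X i

/-- The linear subspace of `K^(N+1)` whose projectivization is the `k`-th osculating space to `X`
at `p`: the intersection of all hyperplanes `∑ᵢ aᵢ Xᵢ = 0` which have contact of order `> k` with
`X` at `p`, i.e. whose equation restricted to `X` lies in the `(k+1)`-st power of the maximal
ideal of `p`. For a non-singular point and `k = 2`, this is the span of the point and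
of the derivatives of order at most two of a local parametrization. -/
def osculatingSpace (k : ℕ) (X : Set (PSpace K N)) (p : PSpace K N) :
    Submodule K (Fin (N + 1) → K) where
  carrier := {v | ∀ a : Fin (N + 1) → K,
    linForm a ∈ idealOf X ⊔ (RingHom.ker (eval p.rep)) ^ (k + 1) → ∑ i, a i * v i = 0}
  zero_mem' := by intro a _; simp
  add_mem' := by
    intro v w hv hw a ha
    simp [mul_add, Finset.sum_add_distrib, hv a ha, hw a ha]
  smul_mem' := by
    intro c v hv a ha
    have : ∀ i, a i * (c • v) i = c * (a i * v i) := by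
      intro i; simp [mul_left_comm]
    rw [Finset.sum_congr rfl fun i _ => this i, ← Finset.mul_sum, hv a ha, mul_zero]

/-- The (intrinsic) tangent space `T_p X`, identified by the choice of the representative of `p`
with the quotient of the cone over the embedded tangent space by the line `p`. -/
abbrev TangentVectors (X : Set (PSpace K N)) (p : PSpace K N) : Type _ :=
  tangentSpace X p ⧸ p.submodule.submoduleOf (tangentSpace X p)

/-- The value of the second fundamental form of `X` at `p` on the classes of `v` and `w`
(both in the cone over the embedded tangent space) is the class of `u` in the normal space
`K^(N+1) / tangentSpace X p`.

The second fundamental form is the differential of the Gauss map `q ↦ tangentSpace X q`: its value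
on `v` is the homomorphism which sends `w` to the class of any `u` such that, over the dual numbers
`K[ε]`, the vector `w + ε u` is tangent at the point `x + ε v`, that is `df_{x + ε v}(w + ε u) = 0`
for all `f` in the ideal of `X`. The coefficient of `ε` in this equation is the expression below. -/
def IsSecondFundamentalFormValue (X : Set (PSpace K N)) (p : PSpace K N)
    (v w u : Fin (N + 1) → K) : Prop :=
  ∀ f ∈ idealOf X, diff1 f p.rep u + diff2 f p.rep v w = 0

/-- Two tangent vectors are conjugate: the second fundamental form takes the value `0` on them. -/
def IsConjugate (X : Set (PSpace K N)) (p : PSpace K N) (v w : TangentVectors X p) : Prop :=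
  ∀ v' w' : tangentSpace X p, Submodule.Quotient.mk v' = v → Submodule.Quotient.mk w' = w →
    IsSecondFundamentalFormValue X p v' w' 0

/-- Tangent directions at `p`: points of `ℙ(T_p X)`. -/
abbrev Direction (X : Set (PSpace K N)) (p : PSpace K N) : Type _ :=
  Projectivization K (TangentVectors X p)

/-- Two directions are conjugate if the tangent vectors representing them are. A direction is
asymptotic if it is conjugate to itself. -/
def AreConjugateDirections (X : Set (PSpace K N)) (p : PSpace K N) (d e : Direction X p) : Prop :=
  IsConjugate X p d.rep e.rep

/-- An unordered pair of directions, possibly coincident, is a conjugate pair. A coincident pair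
`s(d, d)` is conjugate if and only if `d` is an asymptotic direction. -/
def IsConjugatePair (X : Set (PSpace K N)) (p : PSpace K N) (s : Sym2 (Direction X p)) : Prop :=
  ∀ d e : Direction X p, s = s(d, e) → AreConjugateDirections X p d e

/-- `S` is a `Φ` surface: its second osculating space at the general point has (projective)
dimension `4`. -/
def IsPhiSurface (S : Set (PSpace K N)) : Prop :=
  AtGeneralPoint S fun p => IsNonsingularPoint S p ∧
    Module.finrank K (osculatingSpace 2 S p) = 4 + 1

/-- At a general point of `S` there is exactly one unordered pair of conjugate directions:
either two distinct conjugate directions, or one (doubly counted) asymptotic direction. -/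
def HasUniqueConjugatePair (S : Set (PSpace K N)) : Prop :=
  AtGeneralPoint S fun p => IsNonsingularPoint S p ∧
    ∃! s : Sym2 (Direction S p), IsConjugatePair S p s

/-- The embedded tangent space to `X` at `p`, as a subset of `ℙ^N`. -/
def embeddedTangentSpace (X : Set (PSpace K N)) (p : PSpace K N) : Set (PSpace K N) :=
  {q | q.submodule ≤ tangentSpace X p}

/-- The tangent variety: the closure of the union of the embedded tangent spaces to `X` at its
non-singular points. -/
def tangentVariety (X : Set (PSpace K N)) : Set (PSpace K N) :=
  zariskiClosure {q | ∃ p, IsNonsingularPoint X p ∧ q ∈ embeddedTangentSpace X p}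

/-- The union of the tangent planes to `S` is a variety of dimension `4`, whose embedded tangent
space is fixed along those planes (at its non-singular points). -/
def TangentVarietyIsFourfoldWithFixedTangent (S : Set (PSpace K N)) : Prop :=
  IsProjVariety (tangentVariety S) ∧ HasDim (tangentVariety S) 4 ∧
    ∀ p, IsNonsingularPoint S p → ∀ q ∈ embeddedTangentSpace S p, ∀ q' ∈ embeddedTangentSpace S p,
      IsNonsingularPoint (tangentVariety S) q → IsNonsingularPoint (tangentVariety S) q' →
        embeddedTangentSpace (tangentVariety S) q = embeddedTangentSpace (tangentVariety S) q'

end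

end ProjSurf

/-!
Near a non-singular point the tangent spaces of the affine cone over `S` are spanned by three
polynomial vector fields, and the second osculating space is the span of the tangent space and of
the values of the second fundamental form `II`. So `S` is a `Φ` surface if and only if `II`,
a symmetric bilinear map on the tangent plane, has image of dimension two. Evaluation at an
unordered pair of directions `{[v], [w]}` is the linear functional `q ↦ q(v, w)` on the
three-dimensional space of quadratic forms, and over an algebraically closed field every non-zero
functional arises from exactly one pair; hence the conjugate pair is unique if and only if the
components of `II` span a space of dimension two.

The tangent variety `V` is parametrized by the tangent spaces of `S`. By generic smoothness in
characteristic `0`, its tangent space at a general point `u` of the tangent space at `p` is the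
span of the latter and of `II(u, ·)`. This lies in the second osculating space at `p`, and together
these subspaces span it as `u` varies. If `S` is a `Φ` surface, then `II(u, ·)` has rank two for
general `u`, so the tangent space of `V` is the whole second osculating space, independently of `u`.
Conversely, if it does not depend on `u`, then it is the whole second osculating space.
-/

namespace ProjSurf

open MvPolynomial

section Differential

variable {K F F' σ τ : Type*} [CommRing K] [CommRing F] [Algebra K F] [CommRing F'] [Algebra K F']

/-- The polynomial map `F^σ → F^τ` with components `φ`. For `τ = σ`, its value at `x` is also
read as the value at `x` of the vector field with components `φ`. -/
noncomputable def evalMap (φ : τ → MvPolynomial σ K) (x : σ → F) : τ → F :=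
  fun i => aeval x (φ i)

theorem aeval_evalMap (φ : τ → MvPolynomial σ K) (x : σ → F) (f : MvPolynomial τ K) :
    aeval (evalMap φ x) f = aeval x (bind₁ φ f) :=
  (aeval_bind₁ x φ f).symm

variable [Fintype σ]

/-- The differential `w ↦ ∑ i, ∂ᵢf(x) wᵢ` of a polynomial `f` at a point `x` with values in a
`K`-algebra `F`. -/
noncomputable def differential (x : σ → F) :
    MvPolynomial σ K →ₗ[K] Module.Dual F (σ → F) where
  toFun f := ∑ i, aeval x (pderiv i f) • LinearMap.proj i
  map_add' f g := by simp [add_smul, Finset.sum_add_distrib]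
  map_smul' c f := by simp [Finset.smul_sum]

theorem differential_apply (x : σ → F) (f : MvPolynomial σ K) (w : σ → F) :
    differential x f w = ∑ i, aeval x (pderiv i f) * w i := by
  simp [differential]

theorem differential_mul (x : σ → F) (f g : MvPolynomial σ K) :
    differential x (f * g) = aeval x f • differential x g + aeval x g • differential x f := by
  ext w
  simp [differential_apply, add_mul, Finset.sum_add_distrib, Finset.mul_sum, mul_assoc]

@[simp]
theorem differential_C (x : σ → F) (a : K) : differential x (C a) = 0 := by
  ext w
  simp [differential_apply]

@[simp]
theorem differential_X (x : σ → F) (i : σ) : differential (K := K) x (X i) = LinearMap.proj i := by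
  classical
  ext w
  simp [differential_apply, pderiv_X, Pi.single_apply]

theorem map_differential (h : F →ₐ[K] F') (x : σ → F) (f : MvPolynomial σ K) (w : σ → F) :
    h (differential x f w) = differential (fun i => h (x i)) f fun i => h (w i) := by
  simp only [differential_apply, map_sum, map_mul]
  simp only [← comp_aeval_apply]

theorem derivation_aeval (D : Derivation K F F) (x : σ → F) (f : MvPolynomial σ K) :
    D (aeval x f) = differential x f fun i => D (x i) := by
  induction f using MvPolynomial.induction_on with
  | C a => simp
  | add p q hp hq => simp [hp, hq]
  | mul_X p i hp => simp [differential_mul, hp]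

/-- The Jacobian of the polynomial map `evalMap φ`. For `τ = σ` this is the derivative of the
vector field `φ`. -/
noncomputable def jacobianMap (φ : τ → MvPolynomial σ K) (x : σ → F) :
    (σ → F) →ₗ[F] (τ → F) :=
  LinearMap.pi fun i => differential x (φ i)

@[simp]
theorem jacobianMap_apply (φ : τ → MvPolynomial σ K) (x w : σ → F) (i : τ) :
    jacobianMap φ x w i = differential x (φ i) w := rfl

omit [Fintype σ] in
theorem aeval_differential [Fintype τ] (φ b : τ → MvPolynomial σ K) (f : MvPolynomial τ K)
    (x : σ → F) :
    aeval x (differential φ f b) = differential (evalMap φ x) f (evalMap b x) :=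
  map_differential (aeval x) φ f b

theorem differential_bind₁ [Fintype τ] (φ : τ → MvPolynomial σ K) (f : MvPolynomial τ K)
    (x w : σ → F) :
    differential x (bind₁ φ f) w = differential (evalMap φ x) f (jacobianMap φ x w) := by
  induction f using MvPolynomial.induction_on with
  | C a => simp
  | add p q hp hq => simp [hp, hq]
  | mul_X p i hp => simp [differential_mul, hp, aeval_evalMap, evalMap]

end Differential

section TangentSpace

variable {K F σ τ : Type*} [Fintype σ]

section CommRing

variable [CommRing K] [CommRing F] [Algebra K F]

/-- The conormal space at an `F`-valued point `x` of the affine scheme defined by the ideal `P`: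
the span of the differentials at `x` of the polynomials in `P`. -/
noncomputable def conormalAt (P : Ideal (MvPolynomial σ K)) (x : σ → F) :
    Submodule F (Module.Dual F (σ → F)) :=
  Submodule.span F (differential x '' (P : Set (MvPolynomial σ K)))

/-- The tangent space at an `F`-valued point `x` of the affine scheme defined by the ideal `P`. -/
noncomputable def tangentAt (P : Ideal (MvPolynomial σ K)) (x : σ → F) : Submodule F (σ → F) :=
  (conormalAt P x).dualCoannihilator

theorem mem_tangentAt {P : Ideal (MvPolynomial σ K)} {x w : σ → F} :
    w ∈ tangentAt P x ↔ ∀ f ∈ P, differential x f w = 0 := by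
  rw [tangentAt, conormalAt, ← SetLike.mem_coe, Submodule.coe_dualCoannihilator_span]
  simp

theorem map_jacobianMap_tangentAt_le [Fintype τ] (φ : τ → MvPolynomial σ K)
    {P : Ideal (MvPolynomial σ K)} {Q : Ideal (MvPolynomial τ K)} (h : ∀ f ∈ Q, bind₁ φ f ∈ P)
    (x : σ → F) :
    (tangentAt P x).map (jacobianMap φ x) ≤ tangentAt Q (evalMap φ x) := by
  rintro _ ⟨w, hw, rfl⟩
  refine mem_tangentAt.2 fun f hf => ?_
  rw [← differential_bind₁]
  exact mem_tangentAt.1 hw _ (h f hf)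

end CommRing

theorem finrank_conormalAt_add_finrank_tangentAt [CommRing K] [Field F] [Algebra K F]
    (P : Ideal (MvPolynomial σ K)) (x : σ → F) :
    Module.finrank F (conormalAt P x) + Module.finrank F (tangentAt P x) = Fintype.card σ :=
  (Subspace.finrank_add_finrank_dualCoannihilator_eq _).trans
    (Module.finrank_fintype_fun_eq_card F)

theorem exists_mem_differential_eq [Field K] {P : Ideal (MvPolynomial σ K)} {x : σ → K}
    {ℓ : Module.Dual K (σ → K)} (hℓ : ∀ w ∈ tangentAt P x, ℓ w = 0) :
    ∃ f ∈ P, differential x f = ℓ := by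
  have hmem : ℓ ∈ ((Submodule.map (differential x) (P.restrictScalars K)).dualCoannihilator
      ).dualAnnihilator := by
    rw [Submodule.mem_dualAnnihilator]
    refine fun w hw => hℓ w (mem_tangentAt.2 fun f hf => ?_)
    exact (Submodule.mem_dualCoannihilator w).1 hw _ ⟨f, hf, rfl⟩
  rwa [Subspace.dualCoannihilator_dualAnnihilator_eq] at hmem

end TangentSpace

section GenericPoint

theorem formallySmooth_of_faithfulSMul (A F : Type*) [CommRing A] [IsDomain A] [Field F]
    [CharZero F] [Algebra A F] [FaithfulSMul A F] : Algebra.FormallySmooth A F := by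
  let _ : Algebra (FractionRing A) F := FractionRing.liftAlgebra A F
  have : CharZero (FractionRing A) := (algebraMap (FractionRing A) F).charZero
  have : Algebra.FormallySmooth A (FractionRing A) := .of_isLocalization (nonZeroDivisors A)
  obtain ⟨ι, t, ht⟩ := exists_isTranscendenceBasis' (FractionRing A) F
  have := ht.isAlgebraic_field
  have : Algebra.FormallySmooth (FractionRing A) F :=
    .of_algebraicIndependent_of_isSeparable ht.1
  exact .comp A (FractionRing A) F

variable {K F σ : Type*} [Field K] [CharZero K] [Field F] [Algebra K F]

theorem exists_derivation_extending {A : Type*} [CommRing A] [IsDomain A] [Algebra K A]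
    [Algebra A F] [IsScalarTower K A F] [FaithfulSMul A F] (d : Derivation K A F) :
    ∃ D : Derivation K F F, ∀ a, D (algebraMap A F a) = d a := by
  have : CharZero F := charZero_of_injective_algebraMap (algebraMap K F).injective
  have := formallySmooth_of_faithfulSMul A F
  have h_inj : Function.Injective (KaehlerDifferential.mapBaseChange K A F) := by
    rw [injective_iff_map_eq_zero]
    intro y hy
    obtain ⟨z, rfl⟩ := (Algebra.H1Cotangent.exact_δ_mapBaseChange K A F y).1 hy
    rw [Subsingleton.elim z 0, map_zero]
  obtain ⟨g, hg⟩ := LinearMap.exists_leftInverse_of_injective _ (LinearMap.ker_eq_bot.2 h_inj)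
  refine ⟨((d.liftKaehlerDifferential.liftBaseChange F).comp g).compDer
    (KaehlerDifferential.D K F), fun a => ?_⟩
  have h_mapBaseChange : KaehlerDifferential.D K F (algebraMap A F a)
      = KaehlerDifferential.mapBaseChange K A F (1 ⊗ₜ KaehlerDifferential.D K A a) := by
    simp
  have h_left := LinearMap.congr_fun hg (1 ⊗ₜ KaehlerDifferential.D K A a)
  rw [LinearMap.comp_apply, LinearMap.id_apply] at h_left
  change d.liftKaehlerDifferential.liftBaseChange F (g (KaehlerDifferential.D K F _)) = _
  rw [h_mapBaseChange, h_left]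
  simp

theorem exists_derivation_of_differential_eq_zero [Fintype σ] (x w : σ → F)
    (h : ∀ f : MvPolynomial σ K, aeval x f = 0 → differential x f w = 0) :
    ∃ D : Derivation K F F, ∀ i, D (x i) = w i := by
  let π : MvPolynomial σ K →ₐ[K] (aeval x : MvPolynomial σ K →ₐ[K] F).range :=
    (aeval x).rangeRestrict
  have hπ : Function.Surjective π := (aeval x).rangeRestrict_surjective
  obtain ⟨δ, hδ⟩ : ∃ δ : (aeval x : MvPolynomial σ K →ₐ[K] F).range →ₗ[K] F,
      ∀ f, δ (π f) = differential x f w := by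
    obtain ⟨ρ, hρ⟩ := π.toLinearMap.exists_rightInverse_of_surjective (LinearMap.range_eq_top.2 hπ)
    refine ⟨((LinearMap.applyₗ w).restrictScalars K).comp ((differential x).comp ρ), fun f => ?_⟩
    have h_ker : aeval x (ρ (π f) - f) = 0 := by
      rw [map_sub, sub_eq_zero]
      exact congrArg Subtype.val (LinearMap.congr_fun hρ (π f))
    have h_sub := h _ h_ker
    rwa [map_sub, LinearMap.sub_apply, sub_eq_zero] at h_sub
  let d : Derivation K (aeval x : MvPolynomial σ K →ₐ[K] F).range F := Derivation.mk' δ (by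
    intro a b
    obtain ⟨f, rfl⟩ := hπ a
    obtain ⟨g, rfl⟩ := hπ b
    rw [← map_mul, hδ, hδ, hδ, differential_mul]
    rfl)
  obtain ⟨D, hD⟩ := exists_derivation_extending d
  refine ⟨D, fun i => ?_⟩
  have hπ_X : algebraMap _ F (π (X i)) = x i := aeval_X x i
  rw [← hπ_X, hD]
  exact (hδ (X i)).trans (by simp)

theorem exists_derivation_of_algebraicIndependent [Finite σ] {x : σ → F}
    (hx : AlgebraicIndependent K x) (c : σ → F) : ∃ D : Derivation K F F, ∀ i, D (x i) = c i := by
  have := Fintype.ofFinite σ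
  refine exists_derivation_of_differential_eq_zero x c fun f hf => ?_
  rw [hx (hf.trans (map_zero _).symm), map_zero, LinearMap.zero_apply]

omit [CharZero K] in
/-- The field of constants of a derivation. -/
def fieldOfConstants (D : Derivation K F F) : IntermediateField K F where
  carrier := {a | D a = 0}
  mul_mem' {a b} ha hb := by
    rw [Set.mem_ofPred_eq] at ha hb ⊢
    rw [D.leibniz, ha, hb, smul_zero, smul_zero, add_zero]
  add_mem' {a b} ha hb := by
    rw [Set.mem_ofPred_eq] at ha hb ⊢
    rw [D.map_add, ha, hb, add_zero]
  algebraMap_mem' := D.map_algebraMap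
  inv_mem' a ha := by
    rw [Set.mem_ofPred_eq] at ha ⊢
    rw [D.leibniz_inv, ha, smul_zero]

theorem derivation_eq_zero_of_isAlgebraic (D : Derivation K F F) {a : F}
    (ha : IsAlgebraic (fieldOfConstants D) a) : D a = 0 := by
  let D' : Derivation (fieldOfConstants D) F F := Derivation.mk'
    { D.toLinearMap.toAddMonoidHom with
      map_smul' c b := by
        have hc : D (c : F) = 0 := c.2
        change D (c • b) = c • D b
        rw [Algebra.smul_def, D.leibniz]
        change (c : F) • D b + b • D (c : F) = _
        rw [hc, smul_zero, add_zero]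
        rfl } D.leibniz
  have h_leibniz := D'.map_aeval (minpoly (fieldOfConstants D) a) a
  have h_separable : Polynomial.aeval a (Polynomial.derivative (minpoly (fieldOfConstants D) a))
      ≠ 0 :=
    (minpoly.irreducible ha.isIntegral).separable.aeval_derivative_ne_zero (minpoly.aeval _ _)
  rw [minpoly.aeval, map_zero, eq_comm, smul_eq_zero] at h_leibniz
  exact h_leibniz.resolve_left h_separable

theorem derivation_eq_zero_of_isTranscendenceBasis {A ι : Type*} [CommRing A] [IsDomain A]
    [Algebra K A] {g : A →ₐ[K] F} (hg : Function.Injective g) {y : ι → A}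
    (hy : IsTranscendenceBasis K y) (D : Derivation K F F) (hD : ∀ i, D (g (y i)) = 0) (a : A) :
    D (g a) = 0 := by
  refine derivation_eq_zero_of_isAlgebraic D ?_
  have hle : Algebra.adjoin K (Set.range y) ≤ (fieldOfConstants D).toSubalgebra.comap g := by
    rw [Algebra.adjoin_le_iff]
    rintro _ ⟨i, rfl⟩
    exact hD i
  let ρ : Algebra.adjoin K (Set.range y) →ₐ[K] fieldOfConstants D :=
    (g.comp (Algebra.adjoin K (Set.range y)).val).codRestrict (fieldOfConstants D).toSubalgebra
      fun b => hle b.2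
  have hρ : Function.Injective ρ := fun b c hbc =>
    Subtype.ext (hg (congrArg Subtype.val hbc))
  exact (hy.isAlgebraic.isAlgebraic a).ringHom_of_comp_eq ρ.toRingHom g.toRingHom hρ rfl

omit [CharZero K] in
theorem exists_isTranscendenceBasis_restrict {A : Type*} [CommRing A] [IsDomain A] [Algebra K A]
    {q : σ → A} (hq : Algebra.adjoin K (Set.range q) = ⊤) :
    ∃ s : Set σ, IsTranscendenceBasis K fun i : s => q i := by
  have : Algebra.IsAlgebraic (Algebra.adjoin K (Set.range q)) A := by
    rw [hq]
    exact ⟨fun a => isAlgebraic_algebraMap (R := (⊤ : Subalgebra K A)) ⟨a, trivial⟩⟩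
  obtain ⟨t, ht_range, ht⟩ := exists_isTranscendenceBasis_subset (R := K) (Set.range q)
  obtain ⟨s, -, hs⟩ := (q ⁻¹' t).exists_subset_bijOn q
  rw [Set.image_preimage_eq_of_subset ht_range] at hs
  have h_comp : ((↑) : t → A) ∘ hs.equiv = fun i : s => q i := rfl
  exact ⟨s, (isTranscendenceBasis_equiv' hs.equiv h_comp).2 ht⟩

omit [CharZero K] in
theorem adjoin_range_mk_X (P : Ideal (MvPolynomial σ K)) :
    Algebra.adjoin K (Set.range fun i => Ideal.Quotient.mk P (X i)) = ⊤ := by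
  have h_range : (Set.range fun i => Ideal.Quotient.mk P (X i)) =
      Ideal.Quotient.mkₐ K P '' Set.range X := by
    rw [← Set.range_comp]
    rfl
  rw [h_range, ← AlgHom.map_adjoin, adjoin_range_X, Algebra.map_top, AlgHom.range_eq_top]
  exact Ideal.Quotient.mkₐ_surjective K P

theorem finrank_tangentAt_eq_trdeg [Fintype σ] {P : Ideal (MvPolynomial σ K)} [P.IsPrime]
    {x : σ → F} (hx : ∀ f, aeval x f = 0 ↔ f ∈ P) {d : ℕ}
    (hd : Algebra.trdeg K (MvPolynomial σ K ⧸ P) = d) :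
    Module.finrank F (tangentAt P x) = d := by
  obtain ⟨s, hs⟩ := exists_isTranscendenceBasis_restrict (adjoin_range_mk_X P)
  have : Fintype s := Fintype.ofFinite s
  let g : MvPolynomial σ K ⧸ P →ₐ[K] F := Ideal.Quotient.liftₐ P (aeval x) fun f => (hx f).2
  have hg : Function.Injective g :=
    RingHom.lift_injective_of_ker_le_ideal P (fun f => (hx f).2) fun f => (hx f).1
  have hg_X (i : σ) : g (Ideal.Quotient.mk P (X i)) = x i := aeval_X x i
  let restrict : tangentAt P x →ₗ[F] (s → F) :=
    (LinearMap.funLeft F F ((↑) : s → σ)).comp (tangentAt P x).subtype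
  have h_inj : Function.Injective restrict := by
    rw [injective_iff_map_eq_zero]
    rintro ⟨w, hw⟩ hw_s
    obtain ⟨D, hD⟩ := exists_derivation_of_differential_eq_zero x w
      fun f hf => mem_tangentAt.1 hw f ((hx f).1 hf)
    have h_zero := derivation_eq_zero_of_isTranscendenceBasis hg hs D fun i => by
      rw [hg_X, hD]
      exact congrFun hw_s i
    ext i
    exact (hD i).symm.trans ((congrArg D (hg_X i)).symm.trans (h_zero _))
  have h_surj : Function.Surjective restrict := by
    intro c
    have h_indep : AlgebraicIndependent K fun i : s => x i := by
      simpa only [Function.comp_def, hg_X] using hs.1.map' hg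
    obtain ⟨D, hD⟩ := exists_derivation_of_algebraicIndependent h_indep c
    refine ⟨⟨fun i => D (x i), mem_tangentAt.2 fun f hf => ?_⟩, funext hD⟩
    rw [← derivation_aeval, (hx f).2 hf, map_zero]
  have h_card : Fintype.card s = d := by
    have h_trdeg := hs.lift_cardinalMk_eq_trdeg
    rw [hd, Cardinal.mk_fintype, Cardinal.lift_natCast, Cardinal.lift_natCast] at h_trdeg
    exact_mod_cast h_trdeg
  rw [(LinearEquiv.ofBijective restrict ⟨h_inj, h_surj⟩).finrank_eq,
    Module.finrank_fintype_fun_eq_card, h_card]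

end GenericPoint

section ExistsGenericPoint

universe u v

variable {K : Type u} {σ : Type v} [Field K]

theorem exists_genericPoint (P : Ideal (MvPolynomial σ K)) [P.IsPrime] :
    ∃ (F : Type max u v) (_ : Field F) (_ : Algebra K F) (ξ : σ → F),
      (∀ f, aeval ξ f = 0 ↔ f ∈ P) ∧
        ∀ a : F, ∃ p q : MvPolynomial σ K, aeval ξ q ≠ 0 ∧ aeval ξ q * a = aeval ξ p := by
  let A := MvPolynomial σ K ⧸ P
  let h : MvPolynomial σ K →ₐ[K] FractionRing A :=
    (IsScalarTower.toAlgHom K A (FractionRing A)).comp (Ideal.Quotient.mkₐ K P)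
  have h_aeval (f : MvPolynomial σ K) :
      aeval (fun i => h (X i)) f = algebraMap A _ (Ideal.Quotient.mk P f) :=
    (aeval_unique h ▸ rfl : aeval (fun i => h (X i)) f = h f)
  refine ⟨FractionRing A, inferInstance, inferInstance, fun i => h (X i), fun f => ?_, fun a => ?_⟩
  · rw [h_aeval, FaithfulSMul.algebraMap_eq_zero_iff, Ideal.Quotient.eq_zero_iff_mem]
  · obtain ⟨p', q', hq', rfl⟩ := IsFractionRing.div_surjective (A := A) a
    obtain ⟨p, rfl⟩ := Ideal.Quotient.mk_surjective p'
    obtain ⟨q, rfl⟩ := Ideal.Quotient.mk_surjective q'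
    have hq : algebraMap A (FractionRing A) (Ideal.Quotient.mk P q) ≠ 0 :=
      IsFractionRing.to_map_ne_zero_of_mem_nonZeroDivisors hq'
    refine ⟨p, q, ?_, ?_⟩
    · rwa [h_aeval]
    · rw [h_aeval, h_aeval, mul_div_cancel₀ _ hq]

end ExistsGenericPoint

section LinearIndependence

theorem exists_det_ne_zero_of_linearIndependent {F ι τ : Type*} [Field F] [Fintype ι]
    [DecidableEq ι] [Finite τ] {v : ι → τ → F} (hv : LinearIndependent F v) :
    ∃ e : ι → τ, (Matrix.of fun j k => v j (e k)).det ≠ 0 := by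
  have := Fintype.ofFinite τ
  let A : Matrix ι τ F := Matrix.of v
  have h_rank : Module.finrank F (Submodule.span F (Set.range A.col)) = Fintype.card ι := by
    rw [← Matrix.rank_eq_finrank_span_cols]
    exact LinearIndependent.rank_matrix hv
  obtain ⟨c, hc_mem, -, hc⟩ := Submodule.exists_fun_fin_finrank_span_eq F (Set.range A.col)
  choose e he using hc_mem
  let ε : ι ≃ Fin (Module.finrank F (Submodule.span F (Set.range A.col))) :=
    Fintype.equivFinOfCardEq h_rank.symm
  refine ⟨e ∘ ε, ?_⟩
  have h_cols : LinearIndependent F (Matrix.of fun j k => v j (e (ε k))).col := by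
    have h_eq : (Matrix.of fun j k => v j (e (ε k))).col = c ∘ ε := by
      funext k
      exact he (ε k)
    rw [h_eq]
    exact hc.comp ε ε.injective
  rw [Matrix.linearIndependent_cols_iff_isUnit, Matrix.isUnit_iff_isUnit_det] at h_cols
  exact h_cols.ne_zero

theorem exists_forall_linearIndependent_evalMap {K F ι σ τ : Type*} [Field K] [Field F]
    [Algebra K F] [Finite ι] [Finite τ] {u : ι → τ → MvPolynomial σ K} {x : σ → F}
    (hu : LinearIndependent F fun j => evalMap (u j) x) :
    ∃ h : MvPolynomial σ K, aeval x h ≠ 0 ∧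
      ∀ y : σ → K, aeval y h ≠ 0 → LinearIndependent K fun j => evalMap (u j) y := by
  classical
  have := Fintype.ofFinite ι
  obtain ⟨e, he⟩ := exists_det_ne_zero_of_linearIndependent hu
  let M : Matrix ι ι (MvPolynomial σ K) := Matrix.of fun j k => u j (e k)
  refine ⟨M.det, by rwa [AlgHom.map_det], fun y hy => ?_⟩
  have h_rows : LinearIndependent K ((aeval y).mapMatrix M).row := by
    rw [Matrix.linearIndependent_rows_iff_isUnit, Matrix.isUnit_iff_isUnit_det, isUnit_iff_ne_zero,
      ← AlgHom.map_det]
    exact hy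
  exact LinearIndependent.of_comp (LinearMap.funLeft K K e) h_rows

end LinearIndependence

section TangentField

variable {K F σ : Type*} [CommRing K] [CommRing F] [Algebra K F] [Fintype σ]

/-- A polynomial vector field `b` is tangent to the affine scheme defined by the ideal `P` if the
derivation `f ↦ ∑ i, ∂ᵢf bᵢ` maps `P` into itself. -/
def IsTangentField (P : Ideal (MvPolynomial σ K)) (b : σ → MvPolynomial σ K) : Prop :=
  ∀ f ∈ P, differential X f b ∈ P

omit [Fintype σ] in
theorem evalMap_X (x : σ → F) : evalMap (X : σ → MvPolynomial σ K) x = x := by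
  funext i
  exact aeval_X x i

theorem aeval_differential_X (x : σ → F) (f : MvPolynomial σ K) (b : σ → MvPolynomial σ K) :
    aeval x (differential X f b) = differential x f (evalMap b x) := by
  rw [aeval_differential, evalMap_X]

theorem IsTangentField.evalMap_mem_tangentAt {P : Ideal (MvPolynomial σ K)}
    {b : σ → MvPolynomial σ K} (hb : IsTangentField P b) {x : σ → F}
    (hx : ∀ f ∈ P, aeval x f = 0) : evalMap b x ∈ tangentAt P x :=
  mem_tangentAt.2 fun f hf => by rw [← aeval_differential_X, hx _ (hb f hf)]

theorem isTangentField_of_evalMap_mem_tangentAt {P : Ideal (MvPolynomial σ K)}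
    {b : σ → MvPolynomial σ K} {x : σ → F} (hx : ∀ f, aeval x f = 0 → f ∈ P)
    (hb : evalMap b x ∈ tangentAt P x) : IsTangentField P b := fun f hf =>
  hx _ (by rw [aeval_differential_X, mem_tangentAt.1 hb f hf])

end TangentField

section TangentFrame

variable {K σ : Type*} [Field K] [Fintype σ]

/-- A moving frame for the tangent spaces of the affine scheme defined by the ideal `P`: tangent
vector fields `field j` which, together with the linear forms `form j`, solve Cramer's rule
for tangent vectors with common denominator `denom`. -/
structure TangentFrame (P : Ideal (MvPolynomial σ K)) (d : ℕ) where
  /-- The locus where the frame degenerates is `denom = 0`. -/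
  denom : MvPolynomial σ K
  field : Fin d → σ → MvPolynomial σ K
  /-- The linear forms dual to the fields, up to the factor `denom`. -/
  form : Fin d → Module.Dual K (σ → K)
  isTangentField : ∀ j, IsTangentField P (field j)
  form_field : ∀ x i j, form i (evalMap (field j) x) = if i = j then aeval x denom else 0
  denom_smul : ∀ x, ∀ w ∈ tangentAt P x,
    aeval x denom • w = ∑ j, form j w • evalMap (field j) x

namespace TangentFrame

variable {P : Ideal (MvPolynomial σ K)} {d : ℕ} (B : TangentFrame P d) {x : σ → K}

theorem linearIndependent (hx : aeval x B.denom ≠ 0) :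
    LinearIndependent K fun j => evalMap (B.field j) x := by
  rw [Fintype.linearIndependent_iff]
  intro c hc i
  have h_form := congrArg (B.form i) hc
  simp only [map_sum, map_smul, B.form_field, smul_eq_mul, mul_ite, mul_zero, map_zero,
    Finset.sum_ite_eq, Finset.mem_univ, if_true] at h_form
  exact (mul_eq_zero.1 h_form).resolve_right hx

theorem tangentAt_eq_span (hx : aeval x B.denom ≠ 0) (hP : ∀ f ∈ P, aeval x f = 0) :
    tangentAt P x = Submodule.span K (Set.range fun j => evalMap (B.field j) x) := by
  refine le_antisymm (fun w hw => ?_) (Submodule.span_le.2 ?_)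
  · rw [← inv_smul_smul₀ hx w, B.denom_smul x w hw]
    exact Submodule.smul_mem _ _ (Submodule.sum_mem _ fun j _ =>
      Submodule.smul_mem _ _ (Submodule.subset_span ⟨j, rfl⟩))
  · rintro _ ⟨j, rfl⟩
    exact (B.isTangentField j).evalMap_mem_tangentAt hP

theorem finrank_tangentAt (hx : aeval x B.denom ≠ 0) (hP : ∀ f ∈ P, aeval x f = 0) :
    Module.finrank K (tangentAt P x) = d := by
  rw [B.tangentAt_eq_span hx hP, finrank_span_eq_card (B.linearIndependent hx), Fintype.card_fin]

end TangentFrame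

end TangentFrame

section Cramer

variable {K F σ : Type*} [CommRing K] [CommRing F] [Algebra K F] [Fintype σ] [DecidableEq σ]

/-- The Jacobian matrix of the polynomials `g`. -/
noncomputable def jacobianMatrix (g : σ → MvPolynomial σ K) : Matrix σ σ (MvPolynomial σ K) :=
  Matrix.of fun r i => pderiv i (g r)

/-- The vector fields given by the columns of the adjugate of the Jacobian matrix. -/
noncomputable def adjugateField (g : σ → MvPolynomial σ K) (r : σ) : σ → MvPolynomial σ K :=
  fun i => (jacobianMatrix g).adjugate i r

theorem mapMatrix_jacobianMatrix_mulVec (g : σ → MvPolynomial σ K) (x w : σ → F) (r : σ) :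
    ((aeval x).mapMatrix (jacobianMatrix g)).mulVec w r = differential x (g r) w := by
  rw [differential_apply]
  rfl

theorem differential_adjugateField (g : σ → MvPolynomial σ K) (x : σ → F) (q r : σ) :
    differential x (g q) (evalMap (adjugateField g r) x) =
      if q = r then aeval x (jacobianMatrix g).det else 0 := by
  have h_mul := congrArg (aeval x) (congrFun (congrFun (jacobianMatrix g).mul_adjugate q) r)
  rw [Matrix.mul_apply, map_sum, Matrix.smul_apply, Matrix.one_apply, smul_eq_mul, mul_ite,
    mul_one, mul_zero, apply_ite (aeval x), map_zero] at h_mul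
  rw [← h_mul, differential_apply]
  exact Finset.sum_congr rfl fun i _ => (map_mul _ _ _).symm

theorem det_smul_eq_sum_adjugateField (g : σ → MvPolynomial σ K) (x w : σ → F) :
    aeval x (jacobianMatrix g).det • w =
      ∑ r, differential x (g r) w • evalMap (adjugateField g r) x := by
  let M : Matrix σ σ F := (aeval x).mapMatrix (jacobianMatrix g)
  have h_adjugate : M.adjugate.mulVec (M.mulVec w) = aeval x (jacobianMatrix g).det • w := by
    rw [Matrix.mulVec_mulVec, Matrix.adjugate_mul, Matrix.smul_mulVec, Matrix.one_mulVec,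
      AlgHom.map_det]
  have h_entry (i r : σ) : M.adjugate i r = evalMap (adjugateField g r) x i := by
    rw [← AlgHom.map_adjugate]
    rfl
  rw [← h_adjugate]
  funext i
  simp only [Matrix.mulVec, dotProduct, Finset.sum_apply, Pi.smul_apply, smul_eq_mul, h_entry]
  exact Finset.sum_congr rfl fun r _ => by
    rw [mul_comm, ← mapMatrix_jacobianMatrix_mulVec]
    rfl

end Cramer

section ExistsTangentFrame

variable {K σ : Type*} [Field K] [Fintype σ]

theorem exists_differential_eq (ℓ : Module.Dual K (σ → K)) :
    ∃ f : MvPolynomial σ K, ∀ x : σ → K, differential x f = ℓ := by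
  classical
  refine ⟨∑ i, ℓ (Pi.single i 1) • X i, fun x => ?_⟩
  ext i
  simp [Pi.single_apply]

theorem exists_basis_of_finrank_eq {V : Type*} [AddCommGroup V] [Module K V]
    [FiniteDimensional K V] {T : Submodule K V} {d : ℕ} (hT : Module.finrank K T = d) :
    ∃ (m : ℕ) (b : Module.Basis (Fin d ⊕ Fin m) K V),
      ∀ w ∈ T, ∀ a, b.coord (Sum.inr a) w = 0 := by
  obtain ⟨C, hC⟩ := T.exists_isCompl
  let b := ((Module.finBasisOfFinrankEq K T hT).prod (Module.finBasis K C)).map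
    (T.prodEquivOfIsCompl C hC)
  refine ⟨_, b, fun w hw a => ?_⟩
  have h_symm := T.prodEquivOfIsCompl_symm_apply_left C hC ⟨w, hw⟩
  simp only [b, Module.Basis.coord_apply, Module.Basis.map_repr, LinearEquiv.trans_apply, h_symm,
    Module.Basis.prod_repr_inr, map_zero, Finsupp.zero_apply]

theorem det_jacobianMatrix_ne_zero [DecidableEq σ] {g : σ → MvPolynomial σ K} {x : σ → K}
    (h : ∀ w, (∀ r, differential x (g r) w = 0) → w = 0) :
    aeval x (jacobianMatrix g).det ≠ 0 := by
  rw [AlgHom.map_det]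
  intro h_det
  obtain ⟨w, hw, h_mulVec⟩ := Matrix.exists_mulVec_eq_zero_iff.2 h_det
  exact hw (h w fun r => by rw [← mapMatrix_jacobianMatrix_mulVec, h_mulVec, Pi.zero_apply])

theorem isTangentField_adjugateField [CharZero K] [DecidableEq σ] {F : Type*} [Field F]
    [Algebra K F] {P : Ideal (MvPolynomial σ K)} [P.IsPrime] {d : ℕ}
    (hd : Algebra.trdeg K (MvPolynomial σ K ⧸ P) = d) {ξ : σ → F}
    (hξ : ∀ f, aeval ξ f = 0 ↔ f ∈ P) {g : σ → MvPolynomial σ K}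
    (hg : (jacobianMatrix g).det ∉ P) {e : Fin d → σ} (he : ∀ r ∉ Set.range e, g r ∈ P)
    (j : Fin d) : IsTangentField P (adjugateField g (e j)) := by
  let S := Submodule.span F (Set.range fun j => evalMap (adjugateField g (e j)) ξ)
  have h_le : tangentAt P ξ ≤ S := by
    intro w hw
    rw [← inv_smul_smul₀ ((hξ _).not.2 hg) w, det_smul_eq_sum_adjugateField]
    refine S.smul_mem _ (S.sum_mem fun r _ => ?_)
    by_cases hr : r ∈ Set.range e
    · obtain ⟨k, rfl⟩ := hr
      exact S.smul_mem _ (Submodule.subset_span ⟨k, rfl⟩)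
    · rw [mem_tangentAt.1 hw _ (he r hr), zero_smul]
      exact S.zero_mem
  have h_eq : tangentAt P ξ = S := Submodule.eq_of_le_of_finrank_le h_le <| by
    rw [finrank_tangentAt_eq_trdeg hξ hd]
    exact (finrank_range_le_card _).trans_eq (Fintype.card_fin d)
  refine isTangentField_of_evalMap_mem_tangentAt (fun f => (hξ f).1) ?_
  rw [h_eq]
  exact Submodule.subset_span ⟨j, rfl⟩

theorem exists_tangentFrame [CharZero K] {P : Ideal (MvPolynomial σ K)} [P.IsPrime] {d : ℕ}
    (hd : Algebra.trdeg K (MvPolynomial σ K ⧸ P) = d) {x : σ → K} (hx : ∀ f ∈ P, aeval x f = 0)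
    (h : Module.finrank K (tangentAt P x) = d) :
    ∃ B : TangentFrame P d, aeval x B.denom ≠ 0 := by
  classical
  obtain ⟨m, b, hb⟩ := exists_basis_of_finrank_eq h
  let ε : σ ≃ Fin d ⊕ Fin m := (Pi.basisFun K σ).indexEquiv b
  choose L hL using fun j => exists_differential_eq (b.coord (Sum.inl j))
  choose f hfP hf using fun a =>
    exists_mem_differential_eq (P := P) (x := x) (ℓ := b.coord (Sum.inr a)) (hb · · a)
  let g : σ → MvPolynomial σ K := fun r => Sum.elim L f (ε r)
  have hg_inl (j : Fin d) : g (ε.symm (Sum.inl j)) = L j := by simp [g]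
  have hg_range (r : σ) (hr : r ∉ Set.range (ε.symm ∘ Sum.inl : Fin d → σ)) : g r ∈ P := by
    obtain ⟨s, rfl⟩ := ε.symm.surjective r
    rcases s with j | a
    · exact absurd ⟨j, rfl⟩ hr
    · simpa [g] using hfP a
  have h_det : aeval x (jacobianMatrix g).det ≠ 0 := by
    refine det_jacobianMatrix_ne_zero fun w hw => b.ext_elem fun s => ?_
    have h_coord := hw (ε.symm s)
    rw [map_zero, Finsupp.zero_apply, ← h_coord]
    rcases s with j | a <;> simp [g, hL, hf]
  obtain ⟨F, _, _, ξ, hξ, -⟩ := exists_genericPoint P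
  have hg : (jacobianMatrix g).det ∉ P := fun h_mem => h_det (hx _ h_mem)
  refine ⟨{
    denom := (jacobianMatrix g).det
    field j := adjugateField g (ε.symm (Sum.inl j))
    form j := b.coord (Sum.inl j)
    isTangentField :=
      isTangentField_adjugateField hd hξ hg hg_range
    form_field y i j := ?_
    denom_smul y w hw := ?_ }, h_det⟩
  · rw [← hL i y, ← hg_inl, differential_adjugateField]
    simp
  · rw [det_smul_eq_sum_adjugateField, ← ε.symm.sum_comp, Fintype.sum_sum_type,
      Finset.sum_eq_zero (s := (Finset.univ : Finset (Fin m))), add_zero]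
    · exact Finset.sum_congr rfl fun j _ => by rw [hg_inl, hL]
    · intro a _
      rw [mem_tangentAt.1 hw _ (hg_range _ (by simp)), zero_smul]

end ExistsTangentFrame

section PolynomialMap

variable {K F σ τ : Type*} [Field K] [Field F] [Algebra K F] [Fintype σ]

theorem linearIndependent_differential_iff {ι : Type*} (x : σ → F) (f : ι → MvPolynomial σ K) :
    LinearIndependent F (fun a => differential x (f a)) ↔
      LinearIndependent F fun a => evalMap (fun i => pderiv i (f a)) x := by
  classical
  have h_eq : (fun a => differential x (f a)) =
      dotProductEquiv F σ ∘ fun a => evalMap (fun i => pderiv i (f a)) x := by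
    funext a
    refine LinearMap.ext fun w => ?_
    exact differential_apply x (f a) w
  rw [h_eq]
  exact (dotProductEquiv F σ).toLinearMap.linearIndependent_iff (LinearEquiv.ker _)

theorem exists_forall_finrank_tangentAt_le (P : Ideal (MvPolynomial σ K)) (x : σ → F) :
    ∃ h : MvPolynomial σ K, aeval x h ≠ 0 ∧ ∀ y : σ → K, aeval y h ≠ 0 →
      Module.finrank K (tangentAt P y) ≤ Module.finrank F (tangentAt P x) := by
  obtain ⟨ℓ, hℓ_mem, -, hℓ⟩ := Submodule.exists_fun_fin_finrank_span_eq F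
    (differential x '' (P : Set (MvPolynomial σ K)))
  choose f hf hfℓ using hℓ_mem
  rw [← funext hfℓ, linearIndependent_differential_iff] at hℓ
  obtain ⟨h, hx, hy⟩ := exists_forall_linearIndependent_evalMap hℓ
  refine ⟨h, hx, fun y hyh => ?_⟩
  have h_span : Submodule.span K (Set.range fun a => differential y (f a)) ≤ conormalAt P y :=
    Submodule.span_mono (Set.range_subset_iff.2 fun a => ⟨f a, hf a, rfl⟩)
  have h_le : Module.finrank F (conormalAt P x) ≤ Module.finrank K (conormalAt P y) := by
    have h_card := finrank_span_eq_card ((linearIndependent_differential_iff y f).2 (hy y hyh))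
    rw [Fintype.card_fin] at h_card
    exact h_card.ge.trans (Submodule.finrank_mono h_span)
  have h_x := finrank_conormalAt_add_finrank_tangentAt P x
  have h_y := finrank_conormalAt_add_finrank_tangentAt P y
  lia

theorem exists_isTangentField_evalMap_eq_smul {I : Ideal (MvPolynomial σ K)} {ζ : σ → F}
    (hζ : ∀ f, aeval ζ f = 0 ↔ f ∈ I)
    (h_frac : ∀ a : F, ∃ p q : MvPolynomial σ K, aeval ζ q ≠ 0 ∧ aeval ζ q * a = aeval ζ p)
    {w : σ → F} (hw : w ∈ tangentAt I ζ) :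
    ∃ b : σ → MvPolynomial σ K, IsTangentField I b ∧ ∃ c : F, c ≠ 0 ∧ evalMap b ζ = c • w := by
  classical
  choose p q hq hpq using fun i => h_frac (w i)
  let b : σ → MvPolynomial σ K := fun i => (∏ j ∈ Finset.univ.erase i, q j) * p i
  have hb : evalMap b ζ = aeval ζ (∏ j, q j) • w := by
    funext i
    rw [Pi.smul_apply, smul_eq_mul, ← Finset.prod_erase_mul _ _ (Finset.mem_univ i), map_mul,
      mul_assoc, hpq, ← map_mul]
    rfl
  refine ⟨b, isTangentField_of_evalMap_mem_tangentAt (fun f => (hζ f).1) ?_, _, ?_, hb⟩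
  · rw [hb]
    exact Submodule.smul_mem _ _ hw
  · rw [map_prod]
    exact Finset.prod_ne_zero_iff.2 fun j _ => hq j

variable [CharZero K] [Fintype τ]

theorem tangentAt_comap_eq_map {I : Ideal (MvPolynomial σ K)} {ζ : σ → F}
    (hζ : ∀ f, aeval ζ f = 0 ↔ f ∈ I) (φ : τ → MvPolynomial σ K) :
    tangentAt (I.comap (bind₁ φ)) (evalMap φ ζ) = (tangentAt I ζ).map (jacobianMap φ ζ) := by
  refine le_antisymm (fun w hw => ?_) (map_jacobianMap_tangentAt_le φ (fun f hf => hf) ζ)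
  obtain ⟨D, hD⟩ := exists_derivation_of_differential_eq_zero (evalMap φ ζ) w fun f hf =>
    mem_tangentAt.1 hw f <| Ideal.mem_comap.2 <| (hζ _).1 <| by rwa [← aeval_evalMap]
  refine ⟨fun i => D (ζ i), mem_tangentAt.2 fun f hf => ?_, funext fun i => ?_⟩
  · rw [← derivation_aeval, (hζ f).2 hf, map_zero]
  · rw [jacobianMap_apply, ← derivation_aeval]
    exact hD i

omit [CharZero K] [Fintype τ] in
theorem evalMap_differential_X (φ : τ → MvPolynomial σ K) (b : σ → MvPolynomial σ K) (x : σ → F) :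
    evalMap (fun i => differential X (φ i) b) x = jacobianMap φ x (evalMap b x) := by
  ext i
  exact aeval_differential_X x (φ i) b

omit [CharZero K] [Fintype τ] in
theorem exists_isTangentField_linearIndependent_jacobianMap [Finite τ]
    {I : Ideal (MvPolynomial σ K)} {ζ : σ → F} (hζ : ∀ f, aeval ζ f = 0 ↔ f ∈ I)
    (h_frac : ∀ a : F, ∃ p q : MvPolynomial σ K, aeval ζ q ≠ 0 ∧ aeval ζ q * a = aeval ζ p)
    (φ : τ → MvPolynomial σ K) {d : ℕ}
    (hd : Module.finrank F ((tangentAt I ζ).map (jacobianMap φ ζ)) = d) :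
    ∃ b : Fin d → σ → MvPolynomial σ K, (∀ k, IsTangentField I (b k)) ∧
      LinearIndependent F fun k => jacobianMap φ ζ (evalMap (b k) ζ) := by
  let e := Module.finBasisOfFinrankEq F ((tangentAt I ζ).map (jacobianMap φ ζ)) hd
  choose w hw hwe using fun k => (e k).2
  choose b hb c hc hbc using fun k => exists_isTangentField_evalMap_eq_smul hζ h_frac (hw k)
  refine ⟨b, hb, ?_⟩
  have h_basis : LinearIndependent F fun k => jacobianMap φ ζ (w k) := by
    rw [funext hwe]
    exact e.linearIndependent.map' (Submodule.subtype _) (Submodule.ker_subtype _)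
  simp only [hbc, map_smul]
  exact h_basis.units_smul fun k => Units.mk0 (c k) (hc k)

theorem exists_tangentAt_comap_eq_map {I : Ideal (MvPolynomial σ K)} [I.IsPrime]
    (φ : τ → MvPolynomial σ K) {d : ℕ}
    (hd : Algebra.trdeg K (MvPolynomial τ K ⧸ I.comap (bind₁ φ)) = d) :
    ∃ h ∉ I, ∀ z : σ → K, (∀ f ∈ I, aeval z f = 0) → aeval z h ≠ 0 →
      Module.finrank K (tangentAt (I.comap (bind₁ φ)) (evalMap φ z)) = d ∧
      tangentAt (I.comap (bind₁ φ)) (evalMap φ z) = (tangentAt I z).map (jacobianMap φ z) := by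
  obtain ⟨F, _, _, ζ, hζ, h_frac⟩ := exists_genericPoint I
  have h_image (f : MvPolynomial τ K) :
      aeval (evalMap φ ζ) f = 0 ↔ f ∈ I.comap (bind₁ φ) := by
    rw [aeval_evalMap, hζ, Ideal.mem_comap]
  have h_finrank := finrank_tangentAt_eq_trdeg h_image hd
  have h_finrank_map := h_finrank
  rw [tangentAt_comap_eq_map hζ] at h_finrank_map
  obtain ⟨g, hg, h_upper⟩ := exists_forall_finrank_tangentAt_le (I.comap (bind₁ φ)) (evalMap φ ζ)
  obtain ⟨b, hb, h_indep⟩ := exists_isTangentField_linearIndependent_jacobianMap hζ h_frac φ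
    h_finrank_map
  simp only [← evalMap_differential_X] at h_indep
  obtain ⟨h, hh, h_lower⟩ := exists_forall_linearIndependent_evalMap h_indep
  refine ⟨bind₁ φ g * h, ?_, fun z hzI hz => ?_⟩
  · rw [← hζ, map_mul, ← aeval_evalMap]
    exact mul_ne_zero hg hh
  rw [map_mul, ← aeval_evalMap] at hz
  have h_le := h_upper _ (left_ne_zero_of_mul hz)
  have h_span : Submodule.span K (Set.range fun k => jacobianMap φ z (evalMap (b k) z)) ≤
      (tangentAt I z).map (jacobianMap φ z) := by
    rw [Submodule.span_le]
    rintro _ ⟨k, rfl⟩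
    exact ⟨_, (hb k).evalMap_mem_tangentAt hzI, rfl⟩
  have h_ge := Submodule.finrank_mono h_span
  have h_indep_z := h_lower z (right_ne_zero_of_mul hz)
  simp only [evalMap_differential_X] at h_indep_z
  have h_card := (finrank_span_eq_card h_indep_z).trans (Fintype.card_fin d)
  have h_map_le := map_jacobianMap_tangentAt_le φ (Q := I.comap (bind₁ φ)) (fun f hf => hf) z
  have h_mono := Submodule.finrank_mono h_map_le
  exact ⟨by lia, (Submodule.eq_of_le_of_finrank_le h_map_le (by lia)).symm⟩

end PolynomialMap

section Cylinder

variable {K σ τ : Type*} [Field K]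

/-- The cylinder `A × K^τ` over a subset `A` of `K^σ`. -/
def cylinder (A : Set (σ → K)) (τ : Type*) : Set (σ ⊕ τ → K) :=
  {z | z ∘ Sum.inl ∈ A}

theorem evalMap_elim_X_C (x : σ → K) (t : τ → K) :
    evalMap (Sum.elim X (C ∘ t) : σ ⊕ τ → MvPolynomial σ K) x = Sum.elim x t := by
  ext (i | j) <;> simp [evalMap]

theorem evalMap_elim_C_X (x : σ → K) (t : τ → K) :
    evalMap (Sum.elim (C ∘ x) X : σ ⊕ τ → MvPolynomial τ K) t = Sum.elim x t := by
  ext (i | j) <;> simp [evalMap]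

theorem aeval_bind₁_elim_X_C (x : σ → K) (t : τ → K) (f : MvPolynomial (σ ⊕ τ) K) :
    aeval x (bind₁ (Sum.elim X (C ∘ t)) f) = aeval (Sum.elim x t) f := by
  rw [← aeval_evalMap, evalMap_elim_X_C]

theorem aeval_bind₁_elim_C_X (x : σ → K) (t : τ → K) (f : MvPolynomial (σ ⊕ τ) K) :
    aeval t (bind₁ (Sum.elim (C ∘ x) X) f) = aeval (Sum.elim x t) f := by
  rw [← aeval_evalMap, evalMap_elim_C_X]

theorem differential_elim [Fintype σ] [Fintype τ] (f : MvPolynomial (σ ⊕ τ) K) (x v : σ → K)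
    (t s : τ → K) :
    differential (Sum.elim x t) f (Sum.elim v s) =
      differential x (bind₁ (Sum.elim X (C ∘ t)) f) v +
        differential t (bind₁ (Sum.elim (C ∘ x) X) f) s := by
  have h_v : jacobianMap (Sum.elim X (C ∘ t) : σ ⊕ τ → MvPolynomial σ K) x v =
      Sum.elim v (0 : τ → K) := by
    ext (i | j) <;> simp
  have h_s : jacobianMap (Sum.elim (C ∘ x) X : σ ⊕ τ → MvPolynomial τ K) t s =
      Sum.elim (0 : σ → K) s := by
    ext (i | j) <;> simp
  rw [differential_bind₁, differential_bind₁, evalMap_elim_X_C, evalMap_elim_C_X, h_v, h_s,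
    ← map_add]
  congr 1
  ext (i | j) <;> simp

theorem mem_vanishingIdeal_cylinder {A : Set (σ → K)} {f : MvPolynomial (σ ⊕ τ) K} :
    f ∈ vanishingIdeal K (cylinder A τ) ↔ ∀ x ∈ A, ∀ t, aeval (Sum.elim x t) f = 0 := by
  rw [mem_vanishingIdeal_iff]
  refine ⟨fun h x hx t => h _ hx, fun h z hz => ?_⟩
  have h_z := h _ hz (z ∘ Sum.inr)
  rwa [Sum.elim_comp_inl_inr] at h_z

theorem bind₁_elim_X_C_mem_vanishingIdeal {A : Set (σ → K)} {f : MvPolynomial (σ ⊕ τ) K}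
    (hf : f ∈ vanishingIdeal K (cylinder A τ)) (t : τ → K) :
    bind₁ (Sum.elim X (C ∘ t)) f ∈ vanishingIdeal K A := by
  rw [mem_vanishingIdeal_iff]
  intro x hx
  rw [aeval_bind₁_elim_X_C, mem_vanishingIdeal_cylinder.1 hf x hx]

variable [Infinite K]

theorem isPrime_vanishingIdeal_cylinder {A : Set (σ → K)} (hA : (vanishingIdeal K A).IsPrime)
    (τ : Type*) : (vanishingIdeal K (cylinder A τ)).IsPrime := by
  refine ⟨fun h_top => hA.ne_top ?_, fun {f g} hfg => ?_⟩
  · rw [Ideal.eq_top_iff_one, mem_vanishingIdeal_cylinder] at h_top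
    rw [Ideal.eq_top_iff_one, mem_vanishingIdeal_iff]
    exact fun x hx => by simpa using h_top x hx 0
  · by_contra! h
    simp only [mem_vanishingIdeal_cylinder, not_forall] at h
    obtain ⟨⟨x, hx, s, hf⟩, ⟨y, hy, t, hg⟩⟩ := h
    have h_ne (x : σ → K) (s : τ → K) (f : MvPolynomial (σ ⊕ τ) K)
        (hf : aeval (Sum.elim x s) f ≠ 0) : bind₁ (Sum.elim (C ∘ x) X) f ≠ 0 := fun h_zero =>
      hf (by rw [← aeval_bind₁_elim_C_X, h_zero, map_zero])
    obtain ⟨u, hu⟩ : ∃ u : τ → K, aeval u (bind₁ (Sum.elim (C ∘ x) X) f *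
        bind₁ (Sum.elim (C ∘ y) X) g) ≠ 0 := by
      by_contra! h_zero
      exact mul_ne_zero (h_ne x s f hf) (h_ne y t g hg)
        (MvPolynomial.funext fun u => (h_zero u).trans (map_zero (eval u)).symm)
    rw [map_mul, aeval_bind₁_elim_C_X, aeval_bind₁_elim_C_X] at hu
    have h_slice := bind₁_elim_X_C_mem_vanishingIdeal hfg u
    rw [map_mul] at h_slice
    rcases hA.mem_or_mem h_slice with h_mem | h_mem
    · have h_x := mem_vanishingIdeal_iff.1 h_mem x hx
      rw [aeval_bind₁_elim_X_C] at h_x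
      exact left_ne_zero_of_mul hu h_x
    · have h_y := mem_vanishingIdeal_iff.1 h_mem y hy
      rw [aeval_bind₁_elim_X_C] at h_y
      exact right_ne_zero_of_mul hu h_y

theorem mem_tangentAt_vanishingIdeal_cylinder [Fintype σ] [Fintype τ] {A : Set (σ → K)}
    {x v : σ → K} (hx : x ∈ A) {t s : τ → K} :
    Sum.elim v s ∈ tangentAt (vanishingIdeal K (cylinder A τ)) (Sum.elim x t) ↔
      v ∈ tangentAt (vanishingIdeal K A) x := by
  simp only [mem_tangentAt]
  refine ⟨fun h f hf => ?_, fun h f hf => ?_⟩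
  · have h_eval (y : σ → K) (u : τ → K) :
        evalMap (fun i => X (Sum.inl i) : σ → MvPolynomial (σ ⊕ τ) K) (Sum.elim y u) = y := by
      ext i
      simp [evalMap]
    have h_diff := h (bind₁ (fun i => X (Sum.inl i)) f) <| mem_vanishingIdeal_cylinder.2
      fun y hy u => by rw [← aeval_evalMap, h_eval, mem_vanishingIdeal_iff.1 hf y hy]
    have h_v : jacobianMap (fun i => X (Sum.inl i) : σ → MvPolynomial (σ ⊕ τ) K) (Sum.elim x t)
        (Sum.elim v s) = v := by
      ext i
      simp
    rwa [differential_bind₁, h_eval, h_v] at h_diff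
  · have h_zero : bind₁ (Sum.elim (C ∘ x) X) f = 0 := MvPolynomial.funext fun u =>
      ((aeval_bind₁_elim_C_X x u f).trans (mem_vanishingIdeal_cylinder.1 hf x hx u)).trans
        (map_zero (eval u)).symm
    rw [differential_elim, h_zero, map_zero, LinearMap.zero_apply, add_zero]
    exact h _ (bind₁_elim_X_C_mem_vanishingIdeal hf t)

end Cylinder

section Density

variable {K σ τ : Type*} [Field K] {A : Set (σ → K)}

theorem exists_aeval_ne_zero {h : MvPolynomial σ K} (hh : h ∉ vanishingIdeal K A) :
    ∃ x ∈ A, aeval x h ≠ 0 := by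
  rw [mem_vanishingIdeal_iff] at hh
  push Not at hh
  exact hh

theorem exists_aeval_elim_ne_zero {f : MvPolynomial (σ ⊕ τ) K}
    (hf : f ∉ vanishingIdeal K (cylinder A τ)) : ∃ x ∈ A, ∃ t, aeval (Sum.elim x t) f ≠ 0 := by
  rw [mem_vanishingIdeal_cylinder] at hf
  push Not at hf
  exact hf

theorem mem_vanishingIdeal_cylinder_of_forall_ne_zero [Infinite K]
    [hA : (vanishingIdeal K A).IsPrime] {f h : MvPolynomial (σ ⊕ τ) K}
    (hh : h ∉ vanishingIdeal K (cylinder A τ))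
    (hf : ∀ x ∈ A, ∀ t, aeval (Sum.elim x t) h ≠ 0 → aeval (Sum.elim x t) f = 0) :
    f ∈ vanishingIdeal K (cylinder A τ) := by
  have h_mul : f * h ∈ vanishingIdeal K (cylinder A τ) := by
    rw [mem_vanishingIdeal_cylinder]
    intro x hx t
    rw [map_mul, mul_eq_zero, or_iff_not_imp_right]
    exact hf x hx t
  exact ((isPrime_vanishingIdeal_cylinder hA τ).mem_or_mem h_mul).resolve_right hh

theorem rename_inl_mem_vanishingIdeal_cylinder {f : MvPolynomial σ K} :
    rename Sum.inl f ∈ vanishingIdeal K (cylinder A τ) ↔ f ∈ vanishingIdeal K A := by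
  rw [mem_vanishingIdeal_cylinder, mem_vanishingIdeal_iff]
  simp only [aeval_rename, Sum.elim_comp_inl]
  exact forall₂_congr fun _ _ => forall_const _

theorem X_inr_notMem_vanishingIdeal_cylinder (hA : (vanishingIdeal K A).IsPrime) (j : τ) :
    X (Sum.inr j) ∉ vanishingIdeal K (cylinder A τ) := by
  intro h_mem
  obtain ⟨x, hx, -⟩ := exists_aeval_ne_zero (hA.one_notMem)
  simpa using mem_vanishingIdeal_cylinder.1 h_mem x hx 1

theorem rename_map_id_mem_vanishingIdeal_cylinder {ρ : Type*} {e : τ → ρ}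
    (he : Function.Injective e) {f : MvPolynomial (σ ⊕ τ) K} :
    rename (Sum.map id e) f ∈ vanishingIdeal K (cylinder A ρ) ↔
      f ∈ vanishingIdeal K (cylinder A τ) := by
  simp only [mem_vanishingIdeal_cylinder, aeval_rename, Sum.elim_comp_map, Function.comp_id]
  refine forall₂_congr fun x _ => ⟨fun h t => ?_, fun h t => h _⟩
  simpa only [Function.extend_comp he] using h (Function.extend e t 0)

end Density

section Hessian

variable {K σ : Type*} [CommRing K]

theorem pderiv_comm (i j : σ) (f : MvPolynomial σ K) :
    pderiv i (pderiv j f) = pderiv j (pderiv i f) := by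
  classical
  have h_comm : ⁅pderiv (R := K) i, pderiv j⁆ = 0 :=
    derivation_ext fun k => by
      rw [Derivation.commutator_apply, pderiv_X, pderiv_X, Derivation.zero_apply]
      simp only [Pi.single_apply]
      split_ifs <;> simp
  have h_apply := Derivation.congr_fun h_comm f
  rwa [Derivation.commutator_apply, Derivation.zero_apply, sub_eq_zero] at h_apply

variable [Fintype σ]

/-- The second differential `(v, w) ↦ ∑ i j, ∂ᵢ∂ⱼf(x) vᵢ wⱼ` of a polynomial `f` at a point `x`. -/
noncomputable def hessian (x : σ → K) : MvPolynomial σ K →ₗ[K] LinearMap.BilinForm K (σ → K) where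
  toFun f := ∑ i, (differential x (pderiv i f)).smulRight (LinearMap.proj i)
  map_add' f g := by
    ext v w
    simp [add_mul, Finset.sum_add_distrib]
  map_smul' c f := by
    ext v w
    simp [Finset.mul_sum, mul_assoc]

theorem hessian_apply (x : σ → K) (f : MvPolynomial σ K) (v w : σ → K) :
    hessian x f v w = ∑ i, differential x (pderiv i f) v * w i := by
  simp [hessian]

theorem hessian_comm (x : σ → K) (f : MvPolynomial σ K) (v w : σ → K) :
    hessian x f v w = hessian x f w v := by
  simp only [hessian_apply, differential_apply, Finset.sum_mul]
  rw [Finset.sum_comm]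
  refine Finset.sum_congr rfl fun i _ => Finset.sum_congr rfl fun j _ => ?_
  rw [pderiv_comm, mul_right_comm]

theorem hessian_mul (x : σ → K) (f g : MvPolynomial σ K) (v w : σ → K) :
    hessian x (f * g) v w = aeval x f * hessian x g v w + aeval x g * hessian x f v w +
      (differential x f v * differential x g w + differential x g v * differential x f w) := by
  simp only [hessian_apply, differential_apply x _ w, Finset.mul_sum, Derivation.leibniz,
    smul_eq_mul, map_add, differential_mul, LinearMap.add_apply, LinearMap.smul_apply, add_mul,
    ← Finset.sum_add_distrib]
  exact Finset.sum_congr rfl fun i _ => by ring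

theorem differential_differential_X (x : σ → K) (f : MvPolynomial σ K) (b : σ → MvPolynomial σ K)
    (v : σ → K) :
    differential x (differential X f b) v =
      hessian x f v (evalMap b x) + differential x f (jacobianMap b x v) := by
  rw [differential_apply X, hessian_apply, differential_apply x f, map_sum, LinearMap.sum_apply,
    ← Finset.sum_add_distrib]
  refine Finset.sum_congr rfl fun i _ => ?_
  rw [aeval_X_left_apply, differential_mul, LinearMap.add_apply, LinearMap.smul_apply,
    LinearMap.smul_apply, smul_eq_mul, smul_eq_mul, add_comm, mul_comm]
  rfl

end Hessian

section SecondFundamentalForm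

variable {K σ : Type*} [Field K] [Fintype σ]

/-- The differentials at `x` of all equations in `P`. Its kernel is the tangent space, so that its
range is a model of the normal space. -/
noncomputable def conormalMap (P : Ideal (MvPolynomial σ K)) (x : σ → K) :
    (σ → K) →ₗ[K] (P → K) :=
  LinearMap.pi fun f => differential x f.1

/-- The Hessians at `x` of all equations in `P`. On the tangent space this is, up to sign, the
second fundamental form, with values in the model of the normal space given by `conormalMap`. -/
noncomputable def hessianMap (P : Ideal (MvPolynomial σ K)) (x : σ → K) :
    (σ → K) →ₗ[K] (σ → K) →ₗ[K] (P → K) :=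
  LinearMap.mk₂ K (fun v w f => hessian x f.1 v w) (fun _ _ _ => by ext; simp)
    (fun _ _ _ => by ext; simp) (fun _ _ _ => by ext; simp) (fun _ _ _ => by ext; simp)

/-- The linear span of the tangent space at `x` and of the values of the second fundamental
form. -/
noncomputable def secondSpan (P : Ideal (MvPolynomial σ K)) (x : σ → K) : Submodule K (σ → K) :=
  (Submodule.map₂ (hessianMap P x) (tangentAt P x) (tangentAt P x)).comap (conormalMap P x)

/-- The linear span of the tangent space at `x` and of the values of the second fundamental form
on the pairs with first entry `u`. It is tangent to the tangent variety at `u`. -/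
noncomputable def rulingTangent (P : Ideal (MvPolynomial σ K)) (x u : σ → K) :
    Submodule K (σ → K) :=
  ((tangentAt P x).map (hessianMap P x u)).comap (conormalMap P x)

variable {P : Ideal (MvPolynomial σ K)} {x : σ → K}

theorem ker_conormalMap : LinearMap.ker (conormalMap P x) = tangentAt P x := by
  ext v
  simp [conormalMap, mem_tangentAt, LinearMap.mem_ker, _root_.funext_iff]

theorem conormalMap_eq_zero {v : σ → K} (hv : v ∈ tangentAt P x) : conormalMap P x v = 0 := by
  rwa [← LinearMap.mem_ker, ker_conormalMap]

theorem hessianMap_comm (v w : σ → K) : hessianMap P x v w = hessianMap P x w v := by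
  ext f
  exact hessian_comm x f.1 v w

theorem conormalMap_jacobianMap {b : σ → MvPolynomial σ K} (hb : IsTangentField P b) {v : σ → K}
    (hv : v ∈ tangentAt P x) :
    conormalMap P x (jacobianMap b x v) = -hessianMap P x v (evalMap b x) := by
  ext f
  refine eq_neg_of_add_eq_zero_right ((differential_differential_X x f.1 b v).symm.trans ?_)
  exact mem_tangentAt.1 hv _ (hb f f.2)

theorem tangentAt_le_rulingTangent (u : σ → K) : tangentAt P x ≤ rulingTangent P x u :=
  ker_conormalMap.symm.trans_le (LinearMap.ker_le_comap _)

theorem tangentAt_le_secondSpan : tangentAt P x ≤ secondSpan P x :=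
  ker_conormalMap.symm.trans_le (LinearMap.ker_le_comap _)

theorem rulingTangent_le_secondSpan {u : σ → K} (hu : u ∈ tangentAt P x) :
    rulingTangent P x u ≤ secondSpan P x := by
  refine Submodule.comap_mono ?_
  rintro _ ⟨w, hw, rfl⟩
  exact Submodule.apply_mem_map₂ _ hu hw

theorem finrank_comap_of_le_range {V W : Type*} [AddCommGroup V] [Module K V] [Module.Finite K V]
    [AddCommGroup W] [Module K W] (φ : V →ₗ[K] W) {M : Submodule K W}
    (hM : M ≤ LinearMap.range φ) :
    Module.finrank K (M.comap φ) =
      Module.finrank K (LinearMap.ker φ) + Module.finrank K M := by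
  have h_rank := LinearMap.finrank_range_add_finrank_ker (φ.domRestrict (M.comap φ))
  have h_ker := (Submodule.submoduleOfEquivOfLe (LinearMap.ker_le_comap φ (p := M))).finrank_eq
  rw [LinearMap.range_domRestrict, Submodule.map_comap_eq_of_le hM, LinearMap.ker_domRestrict]
    at h_rank
  rw [Submodule.submoduleOf] at h_ker
  omega

theorem hessianMap_self (hX : IsTangentField P X) {v : σ → K}
    (hv : v ∈ tangentAt P x) : hessianMap P x x v = 0 := by
  have h_jac : jacobianMap (X : σ → MvPolynomial σ K) x v = v := by
    ext i
    simp
  have h_eq := conormalMap_jacobianMap hX hv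
  rw [h_jac, conormalMap_eq_zero hv, evalMap_X] at h_eq
  rw [hessianMap_comm, neg_eq_zero.1 h_eq.symm]

variable {d : ℕ} (B : TangentFrame P d) (hB : aeval x B.denom ≠ 0)
  (hx : ∀ f ∈ P, aeval x f = 0)

include hB hx

theorem TangentFrame.map₂_hessianMap_le_range :
    Submodule.map₂ (hessianMap P x) (tangentAt P x) (tangentAt P x) ≤
      LinearMap.range (conormalMap P x) := by
  rw [Submodule.map₂_le]
  intro v hv w hw
  suffices tangentAt P x ≤ (LinearMap.range (conormalMap P x)).comap (hessianMap P x v) from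
    this hw
  rw [B.tangentAt_eq_span hB hx, Submodule.span_le]
  rintro _ ⟨j, rfl⟩
  exact ⟨-jacobianMap (B.field j) x v, by
    rw [map_neg, conormalMap_jacobianMap (B.isTangentField j) hv, neg_neg]⟩

theorem TangentFrame.finrank_secondSpan :
    Module.finrank K (secondSpan P x) = d + Module.finrank K
      (Submodule.map₂ (hessianMap P x) (tangentAt P x) (tangentAt P x)) := by
  rw [secondSpan, finrank_comap_of_le_range _ (B.map₂_hessianMap_le_range hB hx),
    ker_conormalMap, B.finrank_tangentAt hB hx]

theorem TangentFrame.finrank_rulingTangent {u : σ → K} (hu : u ∈ tangentAt P x) :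
    Module.finrank K (rulingTangent P x u) =
      d + Module.finrank K ((tangentAt P x).map (hessianMap P x u)) := by
  have h_range : (tangentAt P x).map (hessianMap P x u) ≤ LinearMap.range (conormalMap P x) := by
    refine le_trans ?_ (B.map₂_hessianMap_le_range hB hx)
    rintro _ ⟨w, hw, rfl⟩
    exact Submodule.apply_mem_map₂ _ hu hw
  rw [rulingTangent, finrank_comap_of_le_range _ h_range, ker_conormalMap,
    B.finrank_tangentAt hB hx]

end SecondFundamentalForm

section MaximalIdealPowers

variable {K σ : Type*} [Field K]

theorem ker_eval_eq_span (x : σ → K) :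
    RingHom.ker (eval x) = Ideal.span (Set.range fun i => X i - C (x i)) := by
  refine le_antisymm (fun g hg => ?_) (Ideal.span_le.2 ?_)
  · set J := Ideal.span (Set.range fun i => (X i - C (x i) : MvPolynomial σ K))
    have h_hom : Ideal.Quotient.mkₐ K J =
        (Algebra.ofId K (MvPolynomial σ K ⧸ J)).comp (aeval x) := algHom_ext fun i => by
      rw [AlgHom.comp_apply, aeval_X]
      exact Ideal.Quotient.eq.2 (Ideal.subset_span ⟨i, rfl⟩)
    have h_g := DFunLike.congr_fun h_hom g
    have h_zero : aeval x g = 0 := RingHom.mem_ker.1 hg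
    rwa [AlgHom.comp_apply, h_zero, map_zero,
      Ideal.Quotient.mkₐ_eq_mk, Ideal.Quotient.eq_zero_iff_mem] at h_g
  · rintro _ ⟨i, rfl⟩
    simp [RingHom.mem_ker]

theorem X_sub_C_mem_ker_eval (x : σ → K) (i : σ) :
    (X i - C (x i) : MvPolynomial σ K) ∈ RingHom.ker (eval x) := by
  simp [RingHom.mem_ker]

theorem derivation_mem_pow {A : Type*} [CommRing A] [Algebra K A] (D : Derivation K A A)
    (m : Ideal A) (k : ℕ) {g : A} (hg : g ∈ m ^ (k + 1)) : D g ∈ m ^ k := by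
  induction k generalizing g with
  | zero => simp
  | succ k ih =>
    rw [pow_succ] at hg
    induction hg using Submodule.mul_induction_on' with
    | mem_mul_mem a ha b hb =>
      rw [D.leibniz, pow_succ', smul_eq_mul, smul_eq_mul, ← pow_succ']
      refine Ideal.add_mem _ (Ideal.mul_mem_right _ _ ha) ?_
      rw [pow_succ']
      exact Ideal.mul_mem_mul hb (ih ha)
    | add a _ b _ ha hb => rw [map_add]; exact Ideal.add_mem _ ha hb

variable [Fintype σ]

/-- The Euler derivation centred at `x`. It acts on `m ^ k / m ^ (k + 1)`, where `m` is the maximal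
ideal of `x`, as multiplication by `k`. -/
noncomputable def eulerAt (x : σ → K) : Derivation K (MvPolynomial σ K) (MvPolynomial σ K) :=
  ∑ i, (X i - C (x i)) • pderiv i

theorem eulerAt_apply (x : σ → K) (g : MvPolynomial σ K) :
    eulerAt x g = ∑ i, (X i - C (x i)) * pderiv i g := by
  rw [eulerAt, ← Derivation.coeFnAddMonoidHom_apply, map_sum, Finset.sum_apply]
  rfl

theorem eulerAt_mem_ker_eval (x : σ → K) (g : MvPolynomial σ K) :
    eulerAt x g ∈ RingHom.ker (eval x) := by
  rw [eulerAt_apply]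
  exact Ideal.sum_mem _ fun i _ => Ideal.mul_mem_right _ _ (X_sub_C_mem_ker_eval x i)

theorem eulerAt_X_sub_C (x : σ → K) (i : σ) :
    eulerAt x (X i - C (x i)) = X i - C (x i) := by
  classical
  simp [eulerAt_apply, pderiv_X, Pi.single_apply]

theorem eulerAt_sub_self_mem {x : σ → K} {g : MvPolynomial σ K} (hg : g ∈ RingHom.ker (eval x)) :
    eulerAt x g - g ∈ RingHom.ker (eval x) ^ 2 := by
  rw [ker_eval_eq_span] at hg
  induction hg using Submodule.span_induction with
  | mem _ h =>
    obtain ⟨i, rfl⟩ := h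
    simp [eulerAt_X_sub_C]
  | zero => simp
  | add f g _ _ hf hg =>
    rw [map_add, add_sub_add_comm]
    exact Ideal.add_mem _ hf hg
  | smul a g hg' hg =>
    replace hg' : g ∈ RingHom.ker (eval x) := (ker_eval_eq_span x).symm ▸ hg'
    have h_leibniz : eulerAt x (a • g) - a • g = a * (eulerAt x g - g) + eulerAt x a * g := by
      rw [smul_eq_mul, Derivation.leibniz, smul_eq_mul, smul_eq_mul]
      ring
    rw [h_leibniz, pow_two] at ⊢
    exact Ideal.add_mem _ (Ideal.mul_mem_left _ _ (pow_two (RingHom.ker (eval x)) ▸ hg))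
      (Ideal.mul_mem_mul (eulerAt_mem_ker_eval x a) hg')

theorem eulerAt_sub_natCast_mul_mem {x : σ → K} {k : ℕ} {g : MvPolynomial σ K}
    (hg : g ∈ RingHom.ker (eval x) ^ k) :
    eulerAt x g - (k : MvPolynomial σ K) * g ∈ RingHom.ker (eval x) ^ (k + 1) := by
  induction k generalizing g with
  | zero => simpa using eulerAt_mem_ker_eval x g
  | succ k ih =>
    rw [pow_succ] at hg
    induction hg using Submodule.mul_induction_on' with
    | mem_mul_mem a ha b hb =>
      have h_leibniz : eulerAt x (a * b) - ((k + 1 : ℕ) : MvPolynomial σ K) * (a * b) =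
          (eulerAt x a - (k : MvPolynomial σ K) * a) * b + a * (eulerAt x b - b) := by
        rw [Derivation.leibniz, smul_eq_mul, smul_eq_mul]
        push_cast
        ring
      rw [h_leibniz]
      refine Ideal.add_mem _ ?_ ?_
      · rw [pow_succ _ (k + 1)]
        exact Ideal.mul_mem_mul (ih ha) hb
      · rw [add_assoc, pow_add]
        exact Ideal.mul_mem_mul ha (eulerAt_sub_self_mem hb)
    | add a _ b _ ha hb =>
      rw [map_add, mul_add, add_sub_add_comm]
      exact Ideal.add_mem _ ha hb

omit [Fintype σ] in
theorem mem_ker_eval_pow_succ_of_pderiv_mem [Finite σ] [CharZero K] {x : σ → K} {k : ℕ}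
    {g : MvPolynomial σ K} (hg : g ∈ RingHom.ker (eval x) ^ (k + 1))
    (h : ∀ i, pderiv i g ∈ RingHom.ker (eval x) ^ (k + 1)) :
    g ∈ RingHom.ker (eval x) ^ (k + 2) := by
  have := Fintype.ofFinite σ
  have h_euler : eulerAt x g ∈ RingHom.ker (eval x) ^ (k + 2) := by
    rw [eulerAt_apply, pow_succ' _ (k + 1)]
    exact Ideal.sum_mem _ fun i _ => Ideal.mul_mem_mul (X_sub_C_mem_ker_eval x i) (h i)
  have h_mul := Ideal.sub_mem _ h_euler (eulerAt_sub_natCast_mul_mem hg)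
  rw [sub_sub_cancel, ← map_natCast (C : K →+* MvPolynomial σ K)] at h_mul
  have h_unit : IsUnit (C ((k + 1 : ℕ) : K) : MvPolynomial σ K) :=
    (Nat.cast_ne_zero.2 k.succ_ne_zero).isUnit.map C
  exact (Ideal.unit_mul_mem_iff_mem _ h_unit).1 h_mul

end MaximalIdealPowers

section Osculating

variable {K σ : Type*} [Field K] [Fintype σ] {x : σ → K}

theorem differential_eq_zero_of_mem_pow_two {f : MvPolynomial σ K}
    (hf : f ∈ RingHom.ker (eval x) ^ 2) : differential x f = 0 := by
  ext v
  rw [differential_apply]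
  refine Finset.sum_eq_zero fun i _ => ?_
  have h_mem := derivation_mem_pow (pderiv i) _ 1 hf
  rw [pow_one, RingHom.mem_ker, ← coe_aeval_eq_eval] at h_mem
  exact mul_eq_zero_of_left h_mem _

theorem hessian_eq_zero_of_mem_pow_three {f : MvPolynomial σ K}
    (hf : f ∈ RingHom.ker (eval x) ^ 3) : hessian x f = 0 := by
  refine LinearMap.ext₂ fun v w => ?_
  rw [hessian_apply]
  refine Finset.sum_eq_zero fun i _ => ?_
  rw [differential_eq_zero_of_mem_pow_two (derivation_mem_pow (pderiv i) _ 2 hf),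
    LinearMap.zero_apply, zero_mul]

theorem mem_ker_eval_pow_two [CharZero K] {f : MvPolynomial σ K} (h_zero : aeval x f = 0)
    (h_diff : differential x f = 0) : f ∈ RingHom.ker (eval x) ^ 2 := by
  classical
  refine mem_ker_eval_pow_succ_of_pderiv_mem (k := 0) (by simpa [RingHom.mem_ker]) fun i => ?_
  have h_i := DFunLike.congr_fun h_diff (Pi.single i 1)
  rw [zero_add, pow_one, RingHom.mem_ker]
  simpa [differential_apply, Pi.single_apply] using h_i

theorem mem_ker_eval_pow_three [CharZero K] {f : MvPolynomial σ K} (h_zero : aeval x f = 0)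
    (h_diff : differential x f = 0) (h_hess : hessian x f = 0) :
    f ∈ RingHom.ker (eval x) ^ 3 := by
  classical
  refine mem_ker_eval_pow_succ_of_pderiv_mem (mem_ker_eval_pow_two h_zero h_diff) fun i =>
    mem_ker_eval_pow_two ?_ ?_
  · have h_i := DFunLike.congr_fun h_diff (Pi.single i 1)
    simpa [differential_apply, Pi.single_apply] using h_i
  · refine LinearMap.ext fun v => ?_
    have h_i := LinearMap.congr_fun₂ h_hess v (Pi.single i 1)
    simpa [hessian_apply, Pi.single_apply] using h_i

theorem exists_mem_hessian_eq_add_flip {P : Ideal (MvPolynomial σ K)}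
    (hx : ∀ f ∈ P, aeval x f = 0) {γ : LinearMap.BilinForm K (σ → K)}
    (hγ : ∀ v, ∀ w ∈ tangentAt P x, γ v w = 0) :
    ∃ g ∈ P, differential x g = 0 ∧ ∀ v w, hessian x g v w = γ v w + γ w v := by
  classical
  have h_ex (i : σ) : ∃ f ∈ P, differential x f = γ (Pi.single i (1 : K) : σ → K) :=
    exists_mem_differential_eq (hγ _)
  choose k hkP hk using h_ex
  have h_expand (v w : σ → K) : ∑ i, v i * differential x (k i) w = γ v w := by
    have h_v : v = ∑ i, v i • (Pi.single i 1 : σ → K) := by ext; simp [Pi.single_apply]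
    conv_rhs => rw [h_v]
    simp [hk]
  refine ⟨∑ i, (X i - C (x i)) * k i, Ideal.sum_mem _ fun i _ => Ideal.mul_mem_left _ _ (hkP i),
    ?_, fun v w => ?_⟩
  · rw [map_sum]
    exact Finset.sum_eq_zero fun i _ => by simp [differential_mul, hx _ (hkP i)]
  · simp only [map_sum, LinearMap.sum_apply, hessian_mul, hx _ (hkP _)]
    simp [Finset.sum_add_distrib, h_expand, mul_comm]

theorem exists_bilinForm_eq_add_flip [CharZero K] {V : Type*} [AddCommGroup V] [Module K V]
    (T : Submodule K V) {β : LinearMap.BilinForm K V} (h_symm : ∀ v w, β v w = β w v)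
    (hβ : ∀ v ∈ T, ∀ w ∈ T, β v w = 0) :
    ∃ γ : LinearMap.BilinForm K V, (∀ v, ∀ w ∈ T, γ v w = 0) ∧
      ∀ v w, β v w = γ v w + γ w v := by
  obtain ⟨p, hp⟩ := LinearMap.exists_extend (LinearMap.id : T →ₗ[K] T)
  set π : V →ₗ[K] V := T.subtype.comp p
  have hπ (v : V) (hv : v ∈ T) : π v = v :=
    congrArg Subtype.val (DFunLike.congr_fun hp (⟨v, hv⟩ : T))
  set ρ : V →ₗ[K] V := LinearMap.id - π
  have h_decomp (v : V) : v = π v + ρ v := (add_sub_cancel (π v) v).symm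
  refine ⟨β.compl₁₂ (π + (2⁻¹ : K) • ρ) ρ, fun v w hw => ?_, fun v w => ?_⟩
  · rw [LinearMap.compl₁₂_apply, show ρ w = 0 from sub_eq_zero.2 (hπ w hw).symm, map_zero]
  · have h_zero : β (π v) (π w) = 0 := hβ _ (p v).2 _ (p w).2
    conv_lhs => rw [h_decomp v, h_decomp w]
    simp only [LinearMap.compl₁₂_apply, map_add, map_smul, LinearMap.add_apply,
      LinearMap.smul_apply, smul_eq_mul, h_zero]
    rw [h_symm (π w) (ρ v), h_symm (ρ w) (ρ v)]
    ring

/-- Subtracting a combination `∑ i, (Xᵢ - xᵢ) kᵢ` with `kᵢ ∈ P` removes the remaining part of the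
Hessian. -/
theorem exists_mem_differential_eq_and_hessian_eq_zero [CharZero K] {P : Ideal (MvPolynomial σ K)}
    (hx : ∀ f ∈ P, aeval x f = 0) {f : MvPolynomial σ K} (hf : f ∈ P)
    (h : ∀ v ∈ tangentAt P x, ∀ w ∈ tangentAt P x, hessian x f v w = 0) :
    ∃ g ∈ P, differential x g = differential x f ∧ hessian x g = 0 := by
  obtain ⟨γ, hγ, h_hess⟩ := exists_bilinForm_eq_add_flip _ (hessian_comm x f) h
  obtain ⟨k, hk, h_diff, h_flip⟩ := exists_mem_hessian_eq_add_flip hx hγ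
  refine ⟨f - k, Ideal.sub_mem _ hf hk, by rw [map_sub, h_diff, sub_zero], ?_⟩
  refine LinearMap.ext₂ fun v w => ?_
  rw [map_sub, LinearMap.sub_apply, LinearMap.sub_apply, h_hess, h_flip, sub_self]
  rfl

theorem TangentFrame.mem_sup_ker_eval_pow_three_iff [CharZero K] {P : Ideal (MvPolynomial σ K)}
    {d : ℕ} (B : TangentFrame P d) (hB : aeval x B.denom ≠ 0) (hx : ∀ f ∈ P, aeval x f = 0)
    {f : MvPolynomial σ K} (hfx : aeval x f = 0) (hf : hessian x f = 0) :
    f ∈ P ⊔ RingHom.ker (eval x) ^ 3 ↔ ∀ v ∈ secondSpan P x, differential x f v = 0 := by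
  refine ⟨fun h_mem v hv => ?_, fun h_span => ?_⟩
  · obtain ⟨g, hg, r, hr, rfl⟩ := Submodule.mem_sup.1 h_mem
    rw [map_add, hessian_eq_zero_of_mem_pow_three hr, add_zero] at hf
    rw [map_add, differential_eq_zero_of_mem_pow_two (Ideal.pow_le_pow_right (by decide) hr),
      add_zero]
    have h_le : Submodule.map₂ (hessianMap P x) (tangentAt P x) (tangentAt P x) ≤
        LinearMap.ker (LinearMap.proj ⟨g, hg⟩) :=
      Submodule.map₂_le.2 fun v _ w _ => LinearMap.congr_fun₂ hf v w
    exact h_le hv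
  · obtain ⟨g, hg, h_diff⟩ := exists_mem_differential_eq fun w hw =>
      h_span w (tangentAt_le_secondSpan hw)
    obtain ⟨k, hk, hk_diff, hk_hess⟩ := exists_mem_differential_eq_and_hessian_eq_zero hx hg
      fun v hv w hw => by
        have h_val := Submodule.apply_mem_map₂ (hessianMap P x) hv hw
        obtain ⟨u, hu⟩ := B.map₂_hessianMap_le_range hB hx h_val
        have h_u : u ∈ secondSpan P x := by
          rwa [secondSpan, Submodule.mem_comap, hu]
        have h_g : differential x g u = hessian x g v w := congrFun hu ⟨g, hg⟩
        rw [← h_g, h_diff, h_span u h_u]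
    refine Submodule.mem_sup.2 ⟨k, hk, f - k, mem_ker_eval_pow_three ?_ ?_ ?_,
      add_sub_cancel k f⟩
    · rw [map_sub, hfx, hx k hk, sub_zero]
    · rw [map_sub, hk_diff, h_diff, sub_self]
    · rw [map_sub, hf, hk_hess, sub_self]

end Osculating

section Homogeneous

variable {K σ : Type*} [Field K]

theorem eval_smul_of_isHomogeneous {f : MvPolynomial σ K} {n : ℕ} (hf : f.IsHomogeneous n)
    (c : K) (x : σ → K) : eval (c • x) f = c ^ n * eval x f := by
  rw [eval_eq, eval_eq, Finset.mul_sum]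
  refine Finset.sum_congr rfl fun d hd => ?_
  simp only [Pi.smul_apply, smul_eq_mul, mul_pow, Finset.prod_mul_distrib,
    Finset.prod_pow_eq_pow_sum, ← hf.degree_eq_sum_deg_support hd]
  ring

theorem eval_homogeneousComponent_eq_zero [Infinite K] {f : MvPolynomial σ K} {x : σ → K}
    (h : ∀ c : K, c ≠ 0 → eval (c • x) f = 0) (n : ℕ) :
    eval x (homogeneousComponent n f) = 0 := by
  set p : Polynomial K := ∑ k ∈ Finset.range (f.totalDegree + 1),
    Polynomial.C (eval x (homogeneousComponent k f)) * Polynomial.X ^ k with hp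
  have h_eval (c : K) : p.eval c = eval (c • x) f := by
    conv_rhs => rw [← sum_homogeneousComponent f, map_sum]
    rw [hp, Polynomial.eval_finsetSum]
    refine Finset.sum_congr rfl fun k _ => ?_
    rw [eval_smul_of_isHomogeneous (homogeneousComponent_isHomogeneous k f)]
    simpa using mul_comm _ _
  have h_zero : p = 0 := Polynomial.eq_zero_of_infinite_isRoot _ <|
    (Set.finite_singleton (0 : K)).infinite_compl.mono fun c hc => (h_eval c).trans (h c hc)
  rcases lt_or_ge f.totalDegree n with h_lt | h_le
  · rw [homogeneousComponent_eq_zero _ _ h_lt, map_zero]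
  · have h_coeff := congrArg (Polynomial.coeff · n) h_zero
    simpa [hp, Polynomial.finsetSum_coeff, Polynomial.coeff_X_pow, Nat.lt_succ_of_le h_le]
      using h_coeff

theorem exists_mk_rep_eq_smul {V : Type*} [AddCommGroup V] [Module K V] {v : V} (hv : v ≠ 0) :
    ∃ a : K, a ≠ 0 ∧ (Projectivization.mk K v hv).rep = a • v := by
  obtain ⟨a, ha⟩ := Projectivization.exists_smul_eq_mk_rep K v hv
  exact ⟨a, a.ne_zero, ha.symm⟩

theorem mk_smul_eq_mk {V : Type*} [AddCommGroup V] [Module K V] {v : V} {c : K} (hv : v ≠ 0)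
    (hcv : c • v ≠ 0) : Projectivization.mk K (c • v) hcv = Projectivization.mk K v hv :=
  (Projectivization.mk_eq_mk_iff' K _ _ _ _).2 ⟨c, rfl⟩

end Homogeneous

section Cone

variable {K : Type*} [Field K] {N : ℕ} {A : Set (PSpace K N)} {x : Fin (N + 1) → K}

theorem smul_mem_affineCone (hx : x ∈ affineCone A) {c : K} (hc : c ≠ 0) :
    c • x ∈ affineCone A := by
  obtain ⟨h_ne, hxA⟩ := hx
  exact ⟨smul_ne_zero hc h_ne, by rwa [mk_smul_eq_mk h_ne]⟩

theorem rep_mem_affineCone {p : PSpace K N} (hp : p ∈ A) : p.rep ∈ affineCone A :=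
  ⟨p.rep_nonzero, by rwa [p.mk_rep]⟩

theorem homogeneousComponent_mem_idealOf [Infinite K] {f : MvPolynomial (Fin (N + 1)) K}
    (hf : f ∈ idealOf A) (n : ℕ) : homogeneousComponent n f ∈ idealOf A := fun _ hx =>
  eval_homogeneousComponent_eq_zero (fun _ hc => hf _ (smul_mem_affineCone hx hc)) n

theorem isTangentField_X [Infinite K] (A : Set (PSpace K N)) :
    IsTangentField (idealOf A) X := by
  intro f hf
  rw [← sum_homogeneousComponent f, map_sum, LinearMap.sum_apply]
  refine Ideal.sum_mem _ fun n _ => ?_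
  have h_euler : differential X (homogeneousComponent n f) (X : Fin (N + 1) → _) =
      n • homogeneousComponent n f := by
    rw [← (homogeneousComponent_isHomogeneous n f).sum_X_mul_pderiv, differential_apply]
    exact Finset.sum_congr rfl fun i _ => by rw [aeval_X_left_apply, mul_comm]
  rw [h_euler]
  exact nsmul_mem (homogeneousComponent_mem_idealOf hf n) n

theorem mem_tangentAt_idealOf [Infinite K] (hx : x ∈ affineCone A) :
    x ∈ tangentAt (idealOf A) x := by
  have h := (isTangentField_X A).evalMap_mem_tangentAt fun f hf => hf x hx
  rwa [evalMap_X] at h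

theorem exists_homogeneousComponent_notMem {I : Ideal (MvPolynomial (Fin (N + 1)) K)}
    {g : MvPolynomial (Fin (N + 1)) K} (hg : g ∉ I) : ∃ n, homogeneousComponent n g ∉ I := by
  contrapose! hg
  rw [← sum_homogeneousComponent g]
  exact Ideal.sum_mem _ fun n _ => hg n

theorem atGeneralPoint_of_forall_affineCone [Infinite K] {P : PSpace K N → Prop}
    {g : MvPolynomial (Fin (N + 1)) K} (hg : g ∉ idealOf A)
    (h : ∀ x ∈ affineCone A, aeval x g ≠ 0 → ∀ hx : x ≠ 0, P (Projectivization.mk K x hx)) :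
    AtGeneralPoint A P := by
  refine ⟨{p | ∃ n, eval p.rep (homogeneousComponent n g) ≠ 0},
    ⟨Set.range fun n => homogeneousComponent n g, ?_, by ext; simp⟩, ?_, ?_⟩
  · rintro _ ⟨n, rfl⟩
    exact ⟨n, homogeneousComponent_isHomogeneous n g⟩
  · obtain ⟨n, hn⟩ := exists_homogeneousComponent_notMem hg
    obtain ⟨x, ⟨hx, hxA⟩, h_ne⟩ : ∃ x ∈ affineCone A, eval x (homogeneousComponent n g) ≠ 0 := by
      contrapose! hn
      exact hn
    obtain ⟨a, ha, h_rep⟩ := exists_mk_rep_eq_smul (K := K) hx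
    refine ⟨_, hxA, n, ?_⟩
    rw [h_rep, eval_smul_of_isHomogeneous (homogeneousComponent_isHomogeneous n g)]
    exact mul_ne_zero (pow_ne_zero _ ha) h_ne
  · rintro p ⟨hp, n, hn⟩
    obtain ⟨c, hc, h_ne⟩ : ∃ c : K, c ≠ 0 ∧ eval (c • p.rep) g ≠ 0 := by
      contrapose! hn
      exact eval_homogeneousComponent_eq_zero hn n
    have h_p := h _ (smul_mem_affineCone (rep_mem_affineCone hp) hc) h_ne
      (smul_ne_zero hc p.rep_nonzero)
    rwa [mk_smul_eq_mk p.rep_nonzero, p.mk_rep] at h_p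

theorem exists_forall_affineCone_of_atGeneralPoint {P : PSpace K N → Prop}
    (h : AtGeneralPoint A P) : ∃ g ∉ idealOf A,
      ∀ x ∈ affineCone A, aeval x g ≠ 0 → ∀ hx : x ≠ 0, P (Projectivization.mk K x hx) := by
  obtain ⟨U, ⟨F, hF, hU⟩, ⟨p, hpA, hpU⟩, hP⟩ := h
  have h_mem (q : PSpace K N) : q ∈ U ↔ ∃ f ∈ F, eval q.rep f ≠ 0 := by
    rw [← not_iff_not, ← Set.mem_compl_iff, hU]
    simp
  obtain ⟨f, hf, hfp⟩ := (h_mem p).1 hpU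
  obtain ⟨n, hn⟩ := hF f hf
  refine ⟨f, fun hfA => hfp (hfA _ (rep_mem_affineCone hpA)), fun x hxA hfx hx => ?_⟩
  obtain ⟨a, ha, h_rep⟩ := exists_mk_rep_eq_smul (K := K) hx
  refine hP _ ⟨hxA.2, (h_mem _).2 ⟨f, hf, ?_⟩⟩
  rw [h_rep, eval_smul_of_isHomogeneous hn]
  exact mul_ne_zero (pow_ne_zero _ ha) hfx

end Cone

section Scaling

variable {K : Type*} [Field K] {N : ℕ} {A : Set (PSpace K N)} {x : Fin (N + 1) → K} {c : K}

theorem aeval_bind₁_C_mul_X (c : K) (x : Fin (N + 1) → K) (f : MvPolynomial (Fin (N + 1)) K) :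
    aeval x (bind₁ (fun i => C c * X i) f) = aeval (c • x) f := by
  have h_map : evalMap (fun i => C c * X i) x = c • x := by
    ext i
    simp [evalMap]
  rw [← aeval_evalMap, h_map]

theorem bind₁_C_mul_X_mem_idealOf (hc : c ≠ 0) {f : MvPolynomial (Fin (N + 1)) K}
    (hf : f ∈ idealOf A) : bind₁ (fun i => C c * X i) f ∈ idealOf A := fun x hx =>
  (aeval_bind₁_C_mul_X c x f).trans (hf _ (smul_mem_affineCone hx hc))

theorem tangentAt_smul (A : Set (PSpace K N)) (x : Fin (N + 1) → K) (hc : c ≠ 0) :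
    tangentAt (idealOf A) (c • x) = tangentAt (idealOf A) x := by
  have h_le (y : Fin (N + 1) → K) {a : K} (ha : a ≠ 0) :
      tangentAt (idealOf A) y ≤ tangentAt (idealOf A) (a • y) := by
    intro v hv
    rw [mem_tangentAt] at hv ⊢
    intro f hf
    have h_zero := hv _ (bind₁_C_mul_X_mem_idealOf ha hf)
    have h_map : evalMap (fun i => C a * X i) y = a • y := by
      ext i
      simp [evalMap]
    have h_jac : jacobianMap (fun i => C a * X i) y v = a • v := by
      ext i
      simp [differential_mul]
    rw [differential_bind₁, h_map, h_jac, map_smul] at h_zero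
    exact (smul_eq_zero.1 h_zero).resolve_left ha
  refine le_antisymm ?_ (h_le x hc)
  simpa only [inv_smul_smul₀ hc] using h_le (c • x) (inv_ne_zero hc)

theorem tangentSpace_eq_tangentAt (A : Set (PSpace K N)) (p : PSpace K N) :
    tangentSpace A p = tangentAt (idealOf A) p.rep := by
  ext v
  simp [tangentSpace, mem_tangentAt, differential_apply, diff1, aeval_eq_eval]

theorem tangentSpace_mk (A : Set (PSpace K N)) (hx : x ≠ 0) :
    tangentSpace A (Projectivization.mk K x hx) = tangentAt (idealOf A) x := by
  obtain ⟨a, ha, h_rep⟩ := exists_mk_rep_eq_smul (K := K) hx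
  rw [tangentSpace_eq_tangentAt, h_rep, tangentAt_smul A x ha]

theorem linForm_mem_sup_ker_eval_smul_pow (hc : c ≠ 0) {k : ℕ} {a : Fin (N + 1) → K}
    (h : linForm a ∈ idealOf A ⊔ RingHom.ker (eval x) ^ k) :
    linForm a ∈ idealOf A ⊔ RingHom.ker (eval (c • x)) ^ k := by
  set φ : MvPolynomial (Fin (N + 1)) K →ₐ[K] MvPolynomial (Fin (N + 1)) K :=
    bind₁ fun i => C c⁻¹ * X i with hφ
  have h_ideal : Ideal.map φ (idealOf A) ≤ idealOf A :=
    Ideal.map_le_iff_le_comap.2 fun f hf => bind₁_C_mul_X_mem_idealOf (inv_ne_zero hc) hf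
  have h_ker : Ideal.map φ (RingHom.ker (eval x)) ≤ RingHom.ker (eval (c • x)) := by
    refine Ideal.map_le_iff_le_comap.2 fun f hf => RingHom.mem_ker.2 ?_
    refine (aeval_bind₁_C_mul_X c⁻¹ (c • x) f).trans ?_
    rwa [inv_smul_smul₀ hc]
  have h_map := Ideal.mem_map_of_mem φ h
  rw [Ideal.map_sup, Ideal.map_pow] at h_map
  have h_form : linForm a = C c * φ (linForm a) := by
    simp only [linForm, hφ, map_sum, map_mul, bind₁_X_right, algHom_C, algebraMap_eq,
      Finset.mul_sum]
    refine Finset.sum_congr rfl fun i _ => ?_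
    rw [mul_left_comm, ← mul_assoc (C c), ← C_mul, mul_inv_cancel₀ hc, C_1, one_mul]
  rw [h_form]
  exact Ideal.mul_mem_left _ _ (sup_le_sup h_ideal (Ideal.pow_right_mono h_ker k) h_map)

theorem aeval_linForm (a x : Fin (N + 1) → K) : aeval x (linForm a) = ∑ i, a i * x i := by
  simp [linForm]

theorem differential_linForm (a x v : Fin (N + 1) → K) :
    differential x (linForm a) v = ∑ i, a i * v i := by
  simp [linForm, map_sum, differential_mul]

theorem hessian_linForm (a x : Fin (N + 1) → K) : hessian x (linForm a) = 0 := by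
  refine LinearMap.ext₂ fun v w => ?_
  simp [linForm, map_sum, hessian_apply, pderiv_X, Pi.single_apply, apply_ite]

theorem linForm_mem_sup_ker_eval_pow_three_iff [CharZero K] {d : ℕ}
    (B : TangentFrame (idealOf A) d) (hx : x ∈ affineCone A) (hB : aeval x B.denom ≠ 0)
    (a : Fin (N + 1) → K) : linForm a ∈ idealOf A ⊔ RingHom.ker (eval x) ^ 3 ↔
      ∀ v ∈ secondSpan (idealOf A) x, ∑ i, a i * v i = 0 := by
  have h_vanish : ∀ f ∈ idealOf A, aeval x f = 0 := fun f hf => hf x hx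
  have h_iff (h_zero : aeval x (linForm a) = 0) :=
    B.mem_sup_ker_eval_pow_three_iff hB h_vanish h_zero (hessian_linForm a x)
  simp only [differential_linForm] at h_iff
  constructor
  · intro h
    have h_le : idealOf A ⊔ RingHom.ker (eval x) ^ 3 ≤ RingHom.ker (eval x) :=
      sup_le h_vanish (Ideal.pow_le_self three_ne_zero)
    exact (h_iff (h_le h)).1 h
  · intro h
    refine (h_iff ?_).2 h
    rw [aeval_linForm]
    exact h x (tangentAt_le_secondSpan (mem_tangentAt_idealOf hx))

theorem osculatingSpace_mk [CharZero K] {d : ℕ} (B : TangentFrame (idealOf A) d)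
    (hxA : x ∈ affineCone A) (hB : aeval x B.denom ≠ 0) (hx : x ≠ 0) :
    osculatingSpace 2 A (Projectivization.mk K x hx) = secondSpan (idealOf A) x := by
  obtain ⟨c, hc, h_rep⟩ := exists_mk_rep_eq_smul (K := K) hx
  have h_iff (a : Fin (N + 1) → K) :
      linForm a ∈ idealOf A ⊔ RingHom.ker (eval (Projectivization.mk K x hx).rep) ^ 3 ↔
        ∀ v ∈ secondSpan (idealOf A) x, ∑ i, a i * v i = 0 := by
    rw [← linForm_mem_sup_ker_eval_pow_three_iff B hxA hB, h_rep]
    refine ⟨fun h => ?_, linForm_mem_sup_ker_eval_smul_pow hc⟩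
    simpa only [inv_smul_smul₀ hc] using linForm_mem_sup_ker_eval_smul_pow (inv_ne_zero hc) h
  ext v
  refine ⟨fun hv => ?_, fun hv a ha => (h_iff a).1 ha v hv⟩
  by_contra h_notMem
  obtain ⟨φ, hφv, hφ⟩ := Submodule.exists_le_ker_of_notMem h_notMem
  have h_coord (w : Fin (N + 1) → K) : φ w = ∑ i, φ (Pi.single i 1) * w i := by
    have h_w : w = ∑ i, w i • (Pi.single i 1 : Fin (N + 1) → K) := by ext; simp [Pi.single_apply]
    conv_lhs => rw [h_w]
    simp [mul_comm]
  refine hφv ((h_coord v).trans (hv _ ((h_iff _).2 fun w hw => ?_)))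
  rw [← h_coord]
  exact hφ hw

end Scaling

section ConjugatePairs

variable {K U Q : Type*} [Field K] [AddCommGroup U] [Module K U] [AddCommGroup Q] [Module K Q]

/-- An unordered pair of points of `ℙ U`, possibly coincident, is annihilated by a bilinear map:
the abstract form of a pair of conjugate directions. -/
def IsAnnihilatedPair (β : U →ₗ[K] U →ₗ[K] Q) (s : Sym2 (Projectivization K U)) : Prop :=
  ∀ d e, s = s(d, e) → β d.rep e.rep = 0

theorem isAnnihilatedPair_mk_iff {β : U →ₗ[K] U →ₗ[K] Q} (h_symm : ∀ u v, β u v = β v u)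
    {u v : U} (hu : u ≠ 0) (hv : v ≠ 0) :
    IsAnnihilatedPair β s(Projectivization.mk K u hu, Projectivization.mk K v hv) ↔
      β u v = 0 := by
  obtain ⟨a, ha, hua⟩ := exists_mk_rep_eq_smul (K := K) hu
  obtain ⟨b, hb, hvb⟩ := exists_mk_rep_eq_smul (K := K) hv
  have h_rep : β (Projectivization.mk K u hu).rep (Projectivization.mk K v hv).rep = 0 ↔
      β u v = 0 := by
    simp [hua, hvb, ha, hb]
  refine ⟨fun h => h_rep.1 (h _ _ rfl), fun h d e hde => ?_⟩
  rcases Sym2.eq_iff.1 hde with ⟨rfl, rfl⟩ | ⟨rfl, rfl⟩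
  · exact h_rep.2 h
  · rw [h_symm]
    exact h_rep.2 h

/-- The coefficients of the product of two binary linear forms, where the vectors of a plane are
read as linear forms through their coordinates. -/
noncomputable def formMul (b : Module.Basis (Fin 2) K U) : U →ₗ[K] U →ₗ[K] (Fin 3 → K) :=
  LinearMap.mk₂ K (fun u v => ![b.repr u 0 * b.repr v 0,
      b.repr u 0 * b.repr v 1 + b.repr u 1 * b.repr v 0, b.repr u 1 * b.repr v 1])
    (fun _ _ _ => by ext i; fin_cases i <;> simp <;> ring)
    (fun _ _ _ => by ext i; fin_cases i <;> simp <;> ring)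
    (fun _ _ _ => by ext i; fin_cases i <;> simp <;> ring)
    (fun _ _ _ => by ext i; fin_cases i <;> simp <;> ring)

variable (b : Module.Basis (Fin 2) K U)

theorem formMul_apply (u v : U) : formMul b u v = ![b.repr u 0 * b.repr v 0,
    b.repr u 0 * b.repr v 1 + b.repr u 1 * b.repr v 0, b.repr u 1 * b.repr v 1] := rfl

theorem formMul_comm (u v : U) : formMul b u v = formMul b v u := by
  simp only [formMul_apply, mul_comm, add_comm]

variable {b} {u v u' v' : U}

theorem exists_repr_ne_zero (hu : u ≠ 0) : b.repr u 0 ≠ 0 ∨ b.repr u 1 ≠ 0 := by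
  contrapose! hu
  exact b.ext_elem fun i => by fin_cases i <;> simp [hu]

theorem formMul_ne_zero (hu : u ≠ 0) (hv : v ≠ 0) : formMul b u v ≠ 0 := by
  intro h
  have h₀ : b.repr u 0 * b.repr v 0 = 0 := congrFun h 0
  have h₁ : b.repr u 0 * b.repr v 1 + b.repr u 1 * b.repr v 0 = 0 := congrFun h 1
  have h₂ : b.repr u 1 * b.repr v 1 = 0 := congrFun h 2
  rcases exists_repr_ne_zero (b := b) hu with hu | hu <;>
    rcases exists_repr_ne_zero (b := b) hv with hv | hv <;> simp_all

theorem formMul_surjective [IsAlgClosed K] (b : Module.Basis (Fin 2) K U) (k : Fin 3 → K) :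
    ∃ u v, formMul b u v = k := by
  suffices ∃ u v : Fin 2 → K, ![u 0 * v 0, u 0 * v 1 + u 1 * v 0, u 1 * v 1] = k by
    obtain ⟨u, v, h⟩ := this
    exact ⟨b.equivFun.symm u, b.equivFun.symm v, by simpa [formMul_apply, ← b.equivFun_apply]⟩
  by_cases h_lead : k 2 = 0
  · refine ⟨![1, 0], ![k 0, k 1], ?_⟩
    ext i
    fin_cases i <;> simp [h_lead]
  · obtain ⟨z, hz⟩ := IsAlgClosed.exists_root
      (Polynomial.C (k 2) * Polynomial.X ^ 2 + Polynomial.C (k 1) * Polynomial.X +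
        Polynomial.C (k 0)) (by rw [Polynomial.degree_quadratic h_lead]; decide)
    have h_root : k 2 * z ^ 2 + k 1 * z + k 0 = 0 := by simpa using hz
    refine ⟨![-z, 1], ![k 1 + k 2 * z, k 2], ?_⟩
    ext i
    fin_cases i
    · simp
      linear_combination -h_root
    · simp
      ring
    · simp

theorem mk_eq_mk_of_repr_mul_eq (hu : u ≠ 0) (hu' : u' ≠ 0)
    (h : b.repr u 0 * b.repr u' 1 = b.repr u 1 * b.repr u' 0) :
    Projectivization.mk K u hu = Projectivization.mk K u' hu' := by
  have h_smul (i : Fin 2) : b.repr u' i • u = b.repr u i • u' := by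
    refine b.ext_elem fun j => ?_
    fin_cases i <;> fin_cases j <;> simp <;> grind
  rw [Projectivization.mk_eq_mk_iff']
  have of_ne_zero {i : Fin 2} (hi : b.repr u' i ≠ 0) : ∃ a : K, a • u' = u :=
    ⟨(b.repr u' i)⁻¹ * b.repr u i, by rw [mul_smul, ← h_smul, inv_smul_smul₀ hi]⟩
  exact (exists_repr_ne_zero hu').elim of_ne_zero of_ne_zero

theorem mk_eq_mk_of_formMul_eq_smul (hu : u ≠ 0) (hv : v ≠ 0) (hv' : v' ≠ 0) {c : K}
    (h : formMul b u v = c • formMul b u v') :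
    Projectivization.mk K v hv = Projectivization.mk K v' hv' := by
  rw [Projectivization.mk_eq_mk_iff']
  refine ⟨c, Eq.symm (sub_eq_zero.1 ?_)⟩
  by_contra h_ne
  exact formMul_ne_zero (b := b) hu h_ne (by rw [map_sub, map_smul, h, sub_self])

theorem sym2_mk_eq_of_formMul_eq_smul (hu : u ≠ 0) (hv : v ≠ 0) (hu' : u' ≠ 0) (hv' : v' ≠ 0)
    {c : K} (h : formMul b u v = c • formMul b u' v') :
    s(Projectivization.mk K u hu, Projectivization.mk K v hv) =
      s(Projectivization.mk K u' hu', Projectivization.mk K v' hv') := by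
  have of_eq {w w' : U} (hw : w ≠ 0) (hw' : w' ≠ 0) (h : formMul b w w' = c • formMul b u' v')
      (hwu' : Projectivization.mk K w hw = Projectivization.mk K u' hu') :
      s(Projectivization.mk K w hw, Projectivization.mk K w' hw') =
        s(Projectivization.mk K u' hu', Projectivization.mk K v' hv') := by
    obtain ⟨a, rfl⟩ := (Projectivization.mk_eq_mk_iff' K _ _ _ _).1 hwu'
    have ha : a ≠ 0 := left_ne_zero_of_smul hw
    rw [hwu', mk_eq_mk_of_formMul_eq_smul (b := b) (c := a⁻¹ * c) hu' hw' hv']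
    rw [mul_smul, ← h, map_smul, LinearMap.smul_apply, inv_smul_smul₀ ha]
  have h₀ : b.repr u 0 * b.repr v 0 = c * (b.repr u' 0 * b.repr v' 0) := congrFun h 0
  have h₁ : b.repr u 0 * b.repr v 1 + b.repr u 1 * b.repr v 0 =
    c * (b.repr u' 0 * b.repr v' 1 + b.repr u' 1 * b.repr v' 0) := congrFun h 1
  have h₂ : b.repr u 1 * b.repr v 1 = c * (b.repr u' 1 * b.repr v' 1) := congrFun h 2
  -- Both sides are evaluated at the root of `u'`, so one of the two factors on the left vanishes.
  have h_det : (b.repr u 0 * b.repr u' 1 - b.repr u 1 * b.repr u' 0) *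
      (b.repr v 0 * b.repr u' 1 - b.repr v 1 * b.repr u' 0) = 0 := by
    linear_combination b.repr u' 1 ^ 2 * h₀ - b.repr u' 0 * b.repr u' 1 * h₁ +
      b.repr u' 0 ^ 2 * h₂
  rcases mul_eq_zero.1 h_det with h_det | h_det
  · exact of_eq hu hv h (mk_eq_mk_of_repr_mul_eq hu hu' (sub_eq_zero.1 h_det))
  · rw [Sym2.eq_swap]
    exact of_eq hv hu (formMul_comm b v u ▸ h)
      (mk_eq_mk_of_repr_mul_eq hv hu' (sub_eq_zero.1 h_det))

theorem formMul_eq_smul_of_sym2_mk_eq (hu : u ≠ 0) (hv : v ≠ 0) (hu' : u' ≠ 0) (hv' : v' ≠ 0)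
    (h : s(Projectivization.mk K u hu, Projectivization.mk K v hv) =
      s(Projectivization.mk K u' hu', Projectivization.mk K v' hv')) :
    ∃ c : K, formMul b u v = c • formMul b u' v' := by
  rcases Sym2.eq_iff.1 h with ⟨h₁, h₂⟩ | ⟨h₁, h₂⟩ <;>
    obtain ⟨a, rfl⟩ := (Projectivization.mk_eq_mk_iff' K _ _ _ _).1 h₁ <;>
    obtain ⟨a', rfl⟩ := (Projectivization.mk_eq_mk_iff' K _ _ _ _).1 h₂
  · exact ⟨a * a', by simp [mul_smul, smul_comm a]⟩
  · exact ⟨a * a', by simp [mul_smul, smul_comm a, formMul_comm b v' u']⟩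

variable {β : U →ₗ[K] U →ₗ[K] Q}

theorem exists_comp_formMul (b : Module.Basis (Fin 2) K U) (h_symm : ∀ u v, β u v = β v u) :
    ∃ ψ : (Fin 3 → K) →ₗ[K] Q, ∀ u v, β u v = ψ (formMul b u v) := by
  let ψ := Fintype.linearCombination K ![β (b 0) (b 0), β (b 0) (b 1), β (b 1) (b 1)]
  suffices β = (formMul b).compr₂ ψ from ⟨ψ, fun u v => LinearMap.congr_fun₂ this u v⟩
  refine LinearMap.ext_basis b b fun i j => ?_
  fin_cases i <;> fin_cases j <;>
    simp [ψ, formMul_apply, Fintype.linearCombination_apply, Fin.sum_univ_three, h_symm (b 1) (b 0)]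

theorem map₂_top_eq_range [IsAlgClosed K] {ψ : (Fin 3 → K) →ₗ[K] Q}
    (hψ : ∀ u v, β u v = ψ (formMul b u v)) :
    Submodule.map₂ β ⊤ ⊤ = LinearMap.range ψ := by
  refine le_antisymm (Submodule.map₂_le.2 fun u _ v _ => ⟨_, (hψ u v).symm⟩) ?_
  rintro _ ⟨k, rfl⟩
  obtain ⟨u, v, rfl⟩ := formMul_surjective b k
  exact hψ u v ▸ Submodule.apply_mem_map₂ β Submodule.mem_top Submodule.mem_top

theorem formMul_mem_ker_iff {ψ : (Fin 3 → K) →ₗ[K] Q} (hψ : ∀ u v, β u v = ψ (formMul b u v))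
    (hu : u ≠ 0) (hv : v ≠ 0) : formMul b u v ∈ LinearMap.ker ψ ↔
      IsAnnihilatedPair β s(Projectivization.mk K u hu, Projectivization.mk K v hv) := by
  have h_symm (u v : U) : β u v = β v u := by rw [hψ, hψ, formMul_comm]
  rw [isAnnihilatedPair_mk_iff h_symm hu hv, hψ, LinearMap.mem_ker]

theorem existsUnique_isAnnihilatedPair_iff_finrank_ker [IsAlgClosed K] {ψ : (Fin 3 → K) →ₗ[K] Q}
    (hψ : ∀ u v, β u v = ψ (formMul b u v)) :
    (∃! s, IsAnnihilatedPair β s) ↔ Module.finrank K (LinearMap.ker ψ) = 1 := by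
  rw [finrank_eq_one_iff']
  constructor
  · rintro ⟨s, hs, h_unique⟩
    induction s using Sym2.ind with | _ d e
    induction d with | h u hu
    induction e with | h v hv
    refine ⟨⟨formMul b u v, (formMul_mem_ker_iff hψ hu hv).2 hs⟩,
      fun h => formMul_ne_zero hu hv (congrArg Subtype.val h), fun ⟨k, hk⟩ => ?_⟩
    by_cases hk₀ : k = 0
    · exact ⟨0, Subtype.ext (by simp [hk₀])⟩
    obtain ⟨u', v', rfl⟩ := formMul_surjective b k
    have hu' : u' ≠ 0 := by rintro rfl; simp at hk₀
    have hv' : v' ≠ 0 := by rintro rfl; simp at hk₀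
    obtain ⟨c, hc⟩ := formMul_eq_smul_of_sym2_mk_eq (b := b) hu' hv' hu hv
      (h_unique _ ((formMul_mem_ker_iff hψ hu' hv').1 hk))
    exact ⟨c, Subtype.ext hc.symm⟩
  · rintro ⟨⟨k, hk⟩, hk₀, h_span⟩
    obtain ⟨u, v, rfl⟩ := formMul_surjective b k
    have hu : u ≠ 0 := by rintro rfl; simp at hk₀
    have hv : v ≠ 0 := by rintro rfl; simp at hk₀
    refine ⟨_, (formMul_mem_ker_iff hψ hu hv).1 hk, fun s hs => ?_⟩
    induction s using Sym2.ind with | _ d e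
    induction d with | h u' hu'
    induction e with | h v' hv'
    obtain ⟨c, hc⟩ := h_span ⟨_, (formMul_mem_ker_iff hψ hu' hv').2 hs⟩
    exact sym2_mk_eq_of_formMul_eq_smul (c := c) hu' hv' hu hv (congrArg Subtype.val hc).symm

theorem existsUnique_isAnnihilatedPair_iff [IsAlgClosed K] (hU : Module.finrank K U = 2)
    (h_symm : ∀ u v, β u v = β v u) :
    (∃! s, IsAnnihilatedPair β s) ↔ Module.finrank K (Submodule.map₂ β ⊤ ⊤) = 2 := by
  have : Module.Finite K U := Module.finite_of_finrank_eq_succ hU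
  let b := Module.finBasisOfFinrankEq K U hU
  obtain ⟨ψ, hψ⟩ := exists_comp_formMul b h_symm
  rw [existsUnique_isAnnihilatedPair_iff_finrank_ker hψ, map₂_top_eq_range hψ]
  have h_rank := ψ.finrank_range_add_finrank_ker
  rw [Module.finrank_fin_fun] at h_rank
  lia

theorem exists_dual_mk_eq_zero (hU : Module.finrank K U = 2) (d : Projectivization K U) :
    ∃ φ : Module.Dual K U, φ ≠ 0 ∧ ∀ u (hu : u ≠ 0), Projectivization.mk K u hu = d → φ u = 0 := by
  have : Module.Finite K U := Module.finite_of_finrank_eq_succ hU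
  have h_lt : d.submodule < ⊤ :=
    lt_top_iff_ne_top.2 fun h => by
      have h_finrank := d.finrank_submodule
      rw [h, finrank_top] at h_finrank
      lia
  obtain ⟨φ, hφ, h_le⟩ := Submodule.exists_le_ker_of_lt_top _ h_lt
  refine ⟨φ, hφ, ?_⟩
  rintro u hu rfl
  exact h_le (by simp [Submodule.mem_span_singleton_self])

theorem exists_dual_forall_injective (hU : Module.finrank K U = 2)
    (h_symm : ∀ u v, β u v = β v u) (h : ∃! s, IsAnnihilatedPair β s) :
    ∃ φ₁ φ₂ : Module.Dual K U, φ₁ ≠ 0 ∧ φ₂ ≠ 0 ∧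
      ∀ u, φ₁ u ≠ 0 → φ₂ u ≠ 0 → Function.Injective (β u) := by
  obtain ⟨s, -, h_unique⟩ := h
  induction s using Sym2.ind with | _ d e
  obtain ⟨φ₁, hφ₁, h₁⟩ := exists_dual_mk_eq_zero hU d
  obtain ⟨φ₂, hφ₂, h₂⟩ := exists_dual_mk_eq_zero hU e
  refine ⟨φ₁, φ₂, hφ₁, hφ₂, fun u hu₁ hu₂ => ?_⟩
  rw [injective_iff_map_eq_zero]
  intro v huv
  by_contra hv
  have hu : u ≠ 0 := by rintro rfl; simp at hu₁
  rcases Sym2.eq_iff.1 (h_unique _ ((isAnnihilatedPair_mk_iff h_symm hu hv).2 huv)) with h | h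
  · exact hu₁ (h₁ u hu h.1)
  · exact hu₂ (h₂ u hu h.1)

end ConjugatePairs

section Quotient

variable {K V Q : Type*} [Field K] [AddCommGroup V] [Module K V] [AddCommGroup Q] [Module K Q]
  {β : V →ₗ[K] V →ₗ[K] Q} {L : Submodule K V}

theorem map₂_liftQ₂_top (hL : L ≤ LinearMap.ker β) (hL' : L ≤ LinearMap.ker β.flip) :
    Submodule.map₂ (β.liftQ₂ L L hL hL') ⊤ ⊤ = Submodule.map₂ β ⊤ ⊤ := by
  refine le_antisymm (Submodule.map₂_le.2 fun u _ v _ => ?_) (Submodule.map₂_le.2 fun u _ v _ => ?_)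
  · obtain ⟨u, rfl⟩ := L.mkQ_surjective u
    obtain ⟨v, rfl⟩ := L.mkQ_surjective v
    exact Submodule.apply_mem_map₂ β Submodule.mem_top Submodule.mem_top
  · exact Submodule.apply_mem_map₂ (β.liftQ₂ L L hL hL') (m := L.mkQ u) (n := L.mkQ v)
      Submodule.mem_top Submodule.mem_top

theorem exists_dual_forall_finrank_range [IsAlgClosed K] (h_symm : ∀ u v, β u v = β v u)
    (hL : L ≤ LinearMap.ker β) (hV : Module.finrank K (V ⧸ L) = 2)
    (h : Module.finrank K (Submodule.map₂ β ⊤ ⊤) = 2) :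
    ∃ φ₁ φ₂ : Module.Dual K V, φ₁ ≠ 0 ∧ φ₂ ≠ 0 ∧
      ∀ u, φ₁ u ≠ 0 → φ₂ u ≠ 0 → Module.finrank K (LinearMap.range (β u)) = 2 := by
  have h_refl : β.IsRefl := fun u v huv => by rw [h_symm, huv]
  have h_symm_quot (u v : V ⧸ L) : h_refl.liftQ₂ β L hL u v = h_refl.liftQ₂ β L hL v u := by
    obtain ⟨u, rfl⟩ := L.mkQ_surjective u
    obtain ⟨v, rfl⟩ := L.mkQ_surjective v
    exact h_symm u v
  obtain ⟨φ₁, φ₂, hφ₁, hφ₂, h_inj⟩ := exists_dual_forall_injective hV h_symm_quot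
    ((existsUnique_isAnnihilatedPair_iff hV h_symm_quot).2 (by rwa [map₂_liftQ₂_top]))
  have h_comp {φ : Module.Dual K (V ⧸ L)} (hφ : φ ≠ 0) : φ ∘ₗ L.mkQ ≠ 0 := fun h₀ =>
    hφ (LinearMap.cancel_right L.mkQ_surjective |>.1 (h₀.trans (LinearMap.zero_comp _).symm))
  refine ⟨φ₁ ∘ₗ L.mkQ, φ₂ ∘ₗ L.mkQ, h_comp hφ₁, h_comp hφ₂, fun u hu₁ hu₂ => ?_⟩
  have h_range : LinearMap.range (β u) = LinearMap.range (h_refl.liftQ₂ β L hL (L.mkQ u)) := by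
    rw [← LinearMap.range_comp_of_range_eq_top _ L.range_mkQ]
    rfl
  rw [h_range, LinearMap.finrank_range_of_inj (h_inj _ hu₁ hu₂), hV]

end Quotient

section GeneralVector

variable {K V ι : Type*} [Field K] [AddCommGroup V] [Module K V] [Fintype ι]

omit [Fintype ι] in
theorem exists_eval_ne_zero [Infinite K] {g : MvPolynomial ι K} (hg : g ≠ 0) :
    ∃ t, eval t g ≠ 0 := by
  contrapose! hg
  exact MvPolynomial.funext fun t => by rw [hg, map_zero]

theorem exists_forall_eval_ne_zero_dual (b : Module.Basis ι K V)
    {φ : Module.Dual K V} (hφ : φ ≠ 0) {g : MvPolynomial ι K} (hg : g ≠ 0) :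
    ∃ g' ≠ 0, ∀ t, eval t g' ≠ 0 → eval t g ≠ 0 ∧ φ (∑ j, t j • b j) ≠ 0 := by
  classical
  let ℓ : MvPolynomial ι K := ∑ j, C (φ (b j)) * X j
  have h_eval (t : ι → K) : eval t ℓ = φ (∑ j, t j • b j) := by
    simp [ℓ, mul_comm]
  have hℓ : ℓ ≠ 0 := by
    intro hℓ
    refine hφ (b.ext fun j => ?_)
    simpa [hℓ, Pi.single_apply] using (h_eval (Pi.single j 1)).symm
  refine ⟨g * ℓ, mul_ne_zero hg hℓ, fun t ht => ?_⟩
  rw [map_mul, h_eval] at ht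
  exact ⟨left_ne_zero_of_mul ht, right_ne_zero_of_mul ht⟩

theorem eq_top_of_forall_eval_ne_zero_sum_smul_mem [Infinite K] (b : Module.Basis ι K V)
    {L : Submodule K V} {g : MvPolynomial ι K} (hg : g ≠ 0)
    (hL : ∀ t, eval t g ≠ 0 → ∑ j, t j • b j ∈ L) : L = ⊤ := by
  by_contra h_ne
  obtain ⟨φ, hφ, h_ker⟩ := Submodule.exists_le_ker_of_lt_top L (lt_top_iff_ne_top.2 h_ne)
  obtain ⟨g', hg', h_eval⟩ := exists_forall_eval_ne_zero_dual b hφ hg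
  obtain ⟨t, ht⟩ := exists_eval_ne_zero hg'
  exact (h_eval t ht).2 (h_ker (hL t (h_eval t ht).1))

end GeneralVector

section Ruling

variable {K σ : Type*} [Field K] [Fintype σ] {P : Ideal (MvPolynomial σ K)} {d : ℕ}

/-- The parametrization `(x, t) ↦ ∑ j, t j • B_j(x)` of the union of the tangent spaces by the
combinations of the fields `B_j` of a tangent frame. -/
noncomputable def TangentFrame.rulingMap (B : TangentFrame P d) :
    σ → MvPolynomial (σ ⊕ Fin d) K :=
  fun i => ∑ j, X (Sum.inr j) * rename Sum.inl (B.field j i)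

variable (B : TangentFrame P d) {x : σ → K}

theorem TangentFrame.evalMap_rulingMap (x : σ → K) (t : Fin d → K) :
    evalMap B.rulingMap (Sum.elim x t) = ∑ j, t j • evalMap (B.field j) x := by
  ext i
  simp [rulingMap, evalMap, eval_rename]

theorem TangentFrame.evalMap_rulingMap_mem (hx : ∀ f ∈ P, aeval x f = 0) (t : Fin d → K) :
    evalMap B.rulingMap (Sum.elim x t) ∈ tangentAt P x := by
  rw [B.evalMap_rulingMap]
  exact Submodule.sum_mem _ fun j _ =>
    Submodule.smul_mem _ _ ((B.isTangentField j).evalMap_mem_tangentAt hx)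

theorem TangentFrame.exists_evalMap_rulingMap_eq (hB : aeval x B.denom ≠ 0) {v : σ → K}
    (hv : v ∈ tangentAt P x) : ∃ t, evalMap B.rulingMap (Sum.elim x t) = v := by
  refine ⟨fun j => (aeval x B.denom)⁻¹ * B.form j v, ?_⟩
  rw [B.evalMap_rulingMap]
  simp only [mul_smul, ← Finset.smul_sum]
  rw [← B.denom_smul x v hv, inv_smul_smul₀ hB]

theorem TangentFrame.evalMap_rulingMap_ne_zero (hB : aeval x B.denom ≠ 0) {t : Fin d → K}
    (ht : t ≠ 0) : evalMap B.rulingMap (Sum.elim x t) ≠ 0 := by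
  contrapose! ht
  rw [B.evalMap_rulingMap] at ht
  exact _root_.funext (Fintype.linearIndependent_iff.1 (B.linearIndependent hB) t ht)

/-- The values of the fields of a tangent frame, as a basis of the tangent space. -/
noncomputable def TangentFrame.basis (hB : aeval x B.denom ≠ 0) (hx : ∀ f ∈ P, aeval x f = 0) :
    Module.Basis (Fin d) K (tangentAt P x) :=
  (Module.Basis.span (B.linearIndependent hB)).map
    (LinearEquiv.ofEq _ _ (B.tangentAt_eq_span hB hx).symm)

theorem TangentFrame.coe_sum_smul_basis (hB : aeval x B.denom ≠ 0)
    (hx : ∀ f ∈ P, aeval x f = 0) (t : Fin d → K) :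
    ((∑ j, t j • B.basis hB hx j : tangentAt P x) : σ → K) =
      evalMap B.rulingMap (Sum.elim x t) := by
  simp [B.evalMap_rulingMap, basis, Module.Basis.span_apply]

end Ruling

section SecondFundamentalForm

variable {K σ : Type*} [Field K] [Fintype σ] {P : Ideal (MvPolynomial σ K)} {x : σ → K}

theorem map₂_domRestrict₁₂_top {V W Q : Type*} [AddCommGroup V] [Module K V] [AddCommGroup W]
    [Module K W] [AddCommGroup Q] [Module K Q] (β : V →ₗ[K] W →ₗ[K] Q) (T : Submodule K V)
    (T' : Submodule K W) :
    Submodule.map₂ (β.domRestrict₁₂ T T') ⊤ ⊤ = Submodule.map₂ β T T' :=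
  le_antisymm (Submodule.map₂_le.2 fun v _ w _ => Submodule.apply_mem_map₂ _ v.2 w.2)
    (Submodule.map₂_le.2 fun v hv w hw => Submodule.apply_mem_map₂ (β.domRestrict₁₂ T T')
      (m := ⟨v, hv⟩) (n := ⟨w, hw⟩) Submodule.mem_top Submodule.mem_top)

theorem span_submoduleOf_le_ker_hessianMap (hX : IsTangentField P X) {T : Submodule K (σ → K)}
    (hT : T ≤ tangentAt P x) :
    (K ∙ x).submoduleOf T ≤ LinearMap.ker ((hessianMap P x).domRestrict₁₂ T T) := by
  intro v hv
  obtain ⟨c, hc⟩ := Submodule.mem_span_singleton.1 hv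
  refine LinearMap.ext fun w => ?_
  change hessianMap P x (v : σ → K) w = 0
  rw [← Submodule.subtype_apply, ← hc, map_smul, LinearMap.smul_apply, hessianMap_self hX (hT w.2),
    smul_zero]

theorem finrank_quotient_span_submoduleOf {V : Type*} [AddCommGroup V] [Module K V]
    {T : Submodule K V} [Module.Finite K T] {x : V} (hx : x ∈ T) (hx₀ : x ≠ 0) :
    Module.finrank K (T ⧸ (K ∙ x).submoduleOf T) + 1 = Module.finrank K T := by
  rw [← Submodule.finrank_quotient_add_finrank ((K ∙ x).submoduleOf T),
    (Submodule.submoduleOfEquivOfLe ((Submodule.span_singleton_le_iff_mem x T).2 hx)).finrank_eq,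
    finrank_span_singleton hx₀]

theorem TangentFrame.exists_finrank_rulingTangent_eq [IsAlgClosed K] (B : TangentFrame P 3)
    (hB : aeval x B.denom ≠ 0) (hx : ∀ f ∈ P, aeval x f = 0) (hX : IsTangentField P X)
    (hx₀ : x ≠ 0) (h_finrank : Module.finrank K (secondSpan P x) = 5)
    {g : MvPolynomial (Fin 3) K} (hg : g ≠ 0) :
    ∃ t, eval t g ≠ 0 ∧
      Module.finrank K (rulingTangent P x (evalMap B.rulingMap (Sum.elim x t))) = 5 := by
  have hxT : x ∈ tangentAt P x := by simpa only [evalMap_X] using hX.evalMap_mem_tangentAt hx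
  have h_quot : Module.finrank K (tangentAt P x ⧸ (K ∙ x).submoduleOf (tangentAt P x)) = 2 := by
    have := finrank_quotient_span_submoduleOf hxT hx₀
    rw [B.finrank_tangentAt hB hx] at this
    lia
  rw [B.finrank_secondSpan hB hx, ← map₂_domRestrict₁₂_top] at h_finrank
  obtain ⟨φ₁, φ₂, hφ₁, hφ₂, h_range⟩ := exists_dual_forall_finrank_range
    (β := (hessianMap P x).domRestrict₁₂ (tangentAt P x) (tangentAt P x))
    (fun v w => hessianMap_comm (v : σ → K) w) (span_submoduleOf_le_ker_hessianMap hX le_rfl)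
    h_quot (by lia)
  obtain ⟨g₁, hg₁, h₁⟩ := exists_forall_eval_ne_zero_dual (B.basis hB hx) hφ₁ hg
  obtain ⟨g₂, hg₂, h₂⟩ := exists_forall_eval_ne_zero_dual (B.basis hB hx) hφ₂ hg₁
  obtain ⟨t, ht⟩ := exists_eval_ne_zero hg₂
  refine ⟨t, (h₁ t (h₂ t ht).1).1, ?_⟩
  rw [B.finrank_rulingTangent hB hx (B.evalMap_rulingMap_mem hx t),
    ← B.coe_sum_smul_basis hB hx, ← LinearMap.range_domRestrict]
  exact congrArg (3 + ·) (h_range _ (h₁ t (h₂ t ht).1).2 (h₂ t ht).2)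

end SecondFundamentalForm

section ConjugateDirections

variable {K : Type*} [Field K] {N : ℕ} {A : Set (PSpace K N)} {p : PSpace K N}

theorem diff2_eq_hessian (f : MvPolynomial (Fin (N + 1)) K) (x v w : Fin (N + 1) → K) :
    diff2 f x v w = hessian x f v w := by
  simp only [diff2, hessian_apply, differential_apply, Finset.sum_mul, aeval_eq_eval]
  exact Finset.sum_comm

theorem submoduleOf_le_ker_hessianMap [Infinite K] (A : Set (PSpace K N)) (p : PSpace K N) :
    p.submodule.submoduleOf (tangentSpace A p) ≤ LinearMap.ker
      ((hessianMap (idealOf A) p.rep).domRestrict₁₂ (tangentSpace A p) (tangentSpace A p)) := by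
  rw [Projectivization.submodule_eq]
  exact span_submoduleOf_le_ker_hessianMap (isTangentField_X A) (tangentSpace_eq_tangentAt A p).le

/-- The second fundamental form of `A` at `p`, up to sign, with values in the model of the normal
space given by `conormalMap`. -/
noncomputable def secondFundamentalForm [Infinite K] (A : Set (PSpace K N)) (p : PSpace K N) :
    TangentVectors A p →ₗ[K] TangentVectors A p →ₗ[K] (idealOf A → K) :=
  LinearMap.IsRefl.liftQ₂ _ _ (fun _ _ h => (hessianMap_comm _ _).trans h)
    (submoduleOf_le_ker_hessianMap A p)

theorem secondFundamentalForm_comm [Infinite K] (v w : TangentVectors A p) :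
    secondFundamentalForm A p v w = secondFundamentalForm A p w v := by
  obtain ⟨v, rfl⟩ := Submodule.mkQ_surjective _ v
  obtain ⟨w, rfl⟩ := Submodule.mkQ_surjective _ w
  exact hessianMap_comm _ _

theorem isSecondFundamentalFormValue_zero_iff {v w : Fin (N + 1) → K} :
    IsSecondFundamentalFormValue A p v w 0 ↔ hessianMap (idealOf A) p.rep v w = 0 := by
  simp [IsSecondFundamentalFormValue, diff1, diff2_eq_hessian, hessianMap, _root_.funext_iff]

theorem isConjugate_iff [Infinite K] (v w : TangentVectors A p) :
    IsConjugate A p v w ↔ secondFundamentalForm A p v w = 0 := by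
  simp only [IsConjugate, isSecondFundamentalFormValue_zero_iff]
  constructor
  · obtain ⟨v, rfl⟩ := Submodule.mkQ_surjective _ v
    obtain ⟨w, rfl⟩ := Submodule.mkQ_surjective _ w
    exact fun h => h v w rfl rfl
  · rintro h v w rfl rfl
    exact h

theorem isConjugatePair_iff [Infinite K] (s : Sym2 (Direction A p)) :
    IsConjugatePair A p s ↔ IsAnnihilatedPair (secondFundamentalForm A p) s :=
  forall₂_congr fun _ _ => imp_congr_right fun _ => isConjugate_iff _ _

theorem map₂_secondFundamentalForm_top [Infinite K] :
    Submodule.map₂ (secondFundamentalForm A p) ⊤ ⊤ =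
      Submodule.map₂ (hessianMap (idealOf A) p.rep) (tangentAt (idealOf A) p.rep)
        (tangentAt (idealOf A) p.rep) := by
  rw [secondFundamentalForm, map₂_liftQ₂_top, map₂_domRestrict₁₂_top, tangentSpace_eq_tangentAt]

theorem TangentFrame.finrank_tangentVectors [Infinite K] {d : ℕ}
    (B : TangentFrame (idealOf A) (d + 1)) (hp : p ∈ A) (hB : aeval p.rep B.denom ≠ 0) :
    Module.finrank K (TangentVectors A p) = d := by
  have hx (f) (hf : f ∈ idealOf A) : aeval p.rep f = 0 := hf _ (rep_mem_affineCone hp)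
  have h_mem : p.rep ∈ tangentSpace A p := by
    rw [tangentSpace_eq_tangentAt]
    exact mem_tangentAt_idealOf (rep_mem_affineCone hp)
  have h_quot := finrank_quotient_span_submoduleOf h_mem p.rep_nonzero
  rw [← Projectivization.submodule_eq] at h_quot
  have h_finrank : Module.finrank K (tangentSpace A p) = d + 1 := by
    rw [tangentSpace_eq_tangentAt, B.finrank_tangentAt hB hx]
  exact Nat.succ_injective (h_quot.trans h_finrank)

theorem TangentFrame.existsUnique_isConjugatePair_iff [IsAlgClosed K] [CharZero K]
    (B : TangentFrame (idealOf A) 3) (hp : p ∈ A) (hB : aeval p.rep B.denom ≠ 0) :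
    (∃! s : Sym2 (Direction A p), IsConjugatePair A p s) ↔
      Module.finrank K (osculatingSpace 2 A p) = 5 := by
  have hx (f) (hf : f ∈ idealOf A) : aeval p.rep f = 0 := hf _ (rep_mem_affineCone hp)
  have h_osc := osculatingSpace_mk B (rep_mem_affineCone hp) hB p.rep_nonzero
  rw [Projectivization.mk_rep] at h_osc
  rw [existsUnique_congr isConjugatePair_iff, existsUnique_isAnnihilatedPair_iff
    (B.finrank_tangentVectors hp hB) secondFundamentalForm_comm, map₂_secondFundamentalForm_top,
    h_osc, B.finrank_secondSpan hB hx]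
  lia

end ConjugateDirections

section RulingIdeal

variable {K σ : Type*} [Field K] [Fintype σ] {A : Set (σ → K)} {d : ℕ}

theorem exists_tangentFrame_denom_notMem [CharZero K] [(vanishingIdeal K A).IsPrime]
    (hd : Algebra.trdeg K (MvPolynomial σ K ⧸ vanishingIdeal K A) = d) :
    ∃ B : TangentFrame (vanishingIdeal K A) d, B.denom ∉ vanishingIdeal K A := by
  have h_comap : (vanishingIdeal K A).comap (bind₁ X) = vanishingIdeal K A := by
    ext f
    rw [Ideal.mem_comap, bind₁_X_left, AlgHom.id_apply]
  obtain ⟨h, hh, h_tangent⟩ := exists_tangentAt_comap_eq_map (I := vanishingIdeal K A) X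
    (h_comap.symm ▸ hd)
  obtain ⟨x, hxA, hx⟩ := exists_aeval_ne_zero hh
  have hxI : ∀ f ∈ vanishingIdeal K A, aeval x f = 0 := fun f hf => hf x hxA
  have h_finrank := (h_tangent x hxI hx).1
  rw [h_comap, evalMap_X] at h_finrank
  obtain ⟨B, hB⟩ := exists_tangentFrame hd hxI h_finrank
  exact ⟨B, fun h_mem => hB (hxI _ h_mem)⟩

namespace TangentFrame

/-- The ideal of the union of the tangent spaces to `A` at its general points, as the ideal of the
image of `rulingMap`. -/
noncomputable def rulingIdeal (B : TangentFrame (vanishingIdeal K A) d) :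
    Ideal (MvPolynomial σ K) :=
  (vanishingIdeal K (cylinder A (Fin d))).comap (bind₁ B.rulingMap)

variable (B : TangentFrame (vanishingIdeal K A) d)

theorem mem_rulingIdeal {f : MvPolynomial σ K} :
    f ∈ B.rulingIdeal ↔ ∀ x ∈ A, ∀ t, aeval (evalMap B.rulingMap (Sum.elim x t)) f = 0 := by
  simp only [rulingIdeal, Ideal.mem_comap, mem_vanishingIdeal_cylinder, aeval_evalMap]

theorem aeval_rulingMap_eq_zero {x : σ → K} (hx : x ∈ A) (t : Fin d → K) :
    ∀ f ∈ B.rulingIdeal, aeval (evalMap B.rulingMap (Sum.elim x t)) f = 0 :=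
  fun _ hf => B.mem_rulingIdeal.1 hf x hx t

theorem isPrime_rulingIdeal [Infinite K] [hA : (vanishingIdeal K A).IsPrime] :
    B.rulingIdeal.IsPrime :=
  have := isPrime_vanishingIdeal_cylinder hA (Fin d)
  Ideal.comap_isPrime _ _

theorem rulingIdeal_le [Infinite K] [(vanishingIdeal K A).IsPrime]
    (hB : B.denom ∉ vanishingIdeal K A) (B' : TangentFrame (vanishingIdeal K A) d) :
    B.rulingIdeal ≤ B'.rulingIdeal := by
  intro f hf
  refine mem_vanishingIdeal_cylinder_of_forall_ne_zero
    (mt rename_inl_mem_vanishingIdeal_cylinder.1 hB) fun x hx t hxB => ?_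
  rw [aeval_rename, Sum.elim_comp_inl] at hxB
  obtain ⟨s, hs⟩ := B.exists_evalMap_rulingMap_eq hxB
    (B'.evalMap_rulingMap_mem (fun f hf => hf x hx) t)
  rw [← aeval_evalMap, ← hs]
  exact B.mem_rulingIdeal.1 hf x hx s

theorem jacobianMap_rulingMap (x v : σ → K) (t s : Fin d → K) :
    jacobianMap B.rulingMap (Sum.elim x t) (Sum.elim v s) =
      evalMap B.rulingMap (Sum.elim x s) + ∑ j, t j • jacobianMap (B.field j) x v := by
  have h_const (f : MvPolynomial σ K) :
      bind₁ (fun i => C (x i)) f = (C (aeval x f) : MvPolynomial (Fin d) K) :=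
    aeval_algebraMap_apply (MvPolynomial (Fin d) K) x f
  ext i
  simp [differential_elim, rulingMap, evalMap, bind₁_rename, differential_mul, h_const,
    Function.comp_def, Finset.sum_add_distrib, mul_comm (s _), eval_rename, add_comm]

theorem conormalMap_jacobianMap_rulingMap {x v : σ → K} (hx : x ∈ A)
    (hv : v ∈ tangentAt (vanishingIdeal K A) x) (t s : Fin d → K) :
    conormalMap (vanishingIdeal K A) x (jacobianMap B.rulingMap (Sum.elim x t) (Sum.elim v s)) =
      -hessianMap (vanishingIdeal K A) x (evalMap B.rulingMap (Sum.elim x t)) v := by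
  rw [hessianMap_comm, jacobianMap_rulingMap, map_add,
    conormalMap_eq_zero (B.evalMap_rulingMap_mem (fun f hf => hf x hx) s), zero_add,
    B.evalMap_rulingMap x t, map_sum, map_sum, ← Finset.sum_neg_distrib]
  refine Finset.sum_congr rfl fun j _ => ?_
  rw [map_smul, map_smul, conormalMap_jacobianMap (B.isTangentField j) hv, smul_neg]

theorem map_jacobianMap_rulingMap [Infinite K] {x : σ → K} (hx : x ∈ A)
    (hB : aeval x B.denom ≠ 0) (t : Fin d → K) :
    (tangentAt (vanishingIdeal K (cylinder A (Fin d))) (Sum.elim x t)).map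
      (jacobianMap B.rulingMap (Sum.elim x t)) =
        rulingTangent (vanishingIdeal K A) x (evalMap B.rulingMap (Sum.elim x t)) := by
  apply le_antisymm
  · rintro _ ⟨w, hw, rfl⟩
    rw [← Sum.elim_comp_inl_inr w] at hw ⊢
    have hv := (mem_tangentAt_vanishingIdeal_cylinder hx).1 hw
    rw [rulingTangent, Submodule.mem_comap, B.conormalMap_jacobianMap_rulingMap hx hv]
    exact Submodule.neg_mem _ (Submodule.mem_map_of_mem hv)
  · rintro u ⟨v, hv, hvu⟩
    have h_diff : u - jacobianMap B.rulingMap (Sum.elim x t) (Sum.elim (-v) (0 : Fin d → K)) ∈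
        tangentAt (vanishingIdeal K A) x := by
      rw [← ker_conormalMap, LinearMap.mem_ker, map_sub,
        B.conormalMap_jacobianMap_rulingMap hx (Submodule.neg_mem _ hv), map_neg, neg_neg, hvu,
        sub_self]
    obtain ⟨s, hs⟩ := B.exists_evalMap_rulingMap_eq hB h_diff
    refine ⟨Sum.elim (-v) s,
      (mem_tangentAt_vanishingIdeal_cylinder hx).2 (Submodule.neg_mem _ hv), ?_⟩
    rw [jacobianMap_rulingMap, hs, jacobianMap_rulingMap B x _ t 0,
      B.evalMap_rulingMap x 0]
    simp

theorem exists_forall_tangentAt_rulingIdeal [CharZero K] [hA : (vanishingIdeal K A).IsPrime]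
    (hB : B.denom ∉ vanishingIdeal K A) {n : ℕ}
    (hn : Algebra.trdeg K (MvPolynomial σ K ⧸ B.rulingIdeal) = n) :
    ∃ h ∉ vanishingIdeal K (cylinder A (Fin d)), ∀ x ∈ A, ∀ t, aeval (Sum.elim x t) h ≠ 0 →
      aeval x B.denom ≠ 0 ∧
      Module.finrank K (tangentAt B.rulingIdeal (evalMap B.rulingMap (Sum.elim x t))) = n ∧
      tangentAt B.rulingIdeal (evalMap B.rulingMap (Sum.elim x t)) =
        rulingTangent (vanishingIdeal K A) x (evalMap B.rulingMap (Sum.elim x t)) := by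
  have h_infinite := CharZero.infinite K
  have h_prime := isPrime_vanishingIdeal_cylinder hA (Fin d)
  obtain ⟨h, hh, h_tangent⟩ := exists_tangentAt_comap_eq_map B.rulingMap hn
  refine ⟨h * rename Sum.inl B.denom, fun h_mem => (h_prime.mem_or_mem h_mem).elim hh
    (mt rename_inl_mem_vanishingIdeal_cylinder.1 hB), fun x hx t hxt => ?_⟩
  rw [map_mul, aeval_rename, Sum.elim_comp_inl] at hxt
  have hxB := right_ne_zero_of_mul hxt
  rw [← B.map_jacobianMap_rulingMap hx hxB]
  exact ⟨hxB, h_tangent _ (fun f hf => mem_vanishingIdeal_cylinder.1 hf x hx t)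
    (left_ne_zero_of_mul hxt)⟩

end TangentFrame

end RulingIdeal

theorem exists_aeval_elim_eq_differential {K σ τ : Type*} [Field K] [Fintype σ]
    (φ : σ → MvPolynomial (σ ⊕ τ) K) (f : MvPolynomial σ K) (b : σ → MvPolynomial σ K) :
    ∃ D : MvPolynomial (σ ⊕ (τ ⊕ τ)) K, ∀ (x : σ → K) (t t' : τ → K),
      aeval (Sum.elim x (Sum.elim t t')) D = differential (evalMap φ (Sum.elim x t')) f
        (evalMap b (evalMap φ (Sum.elim x t))) := by
  let ψ (e : τ → τ ⊕ τ) (i : σ) : MvPolynomial (σ ⊕ (τ ⊕ τ)) K := rename (Sum.map id e) (φ i)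
  have h_ψ (e : τ → τ ⊕ τ) (x : σ → K) (s : τ ⊕ τ → K) :
      evalMap (ψ e) (Sum.elim x s) = evalMap φ (Sum.elim x (s ∘ e)) := by
    ext i
    simp [ψ, evalMap, eval_rename, Sum.elim_comp_map]
  refine ⟨differential (ψ Sum.inr) f fun i => bind₁ (ψ Sum.inl) (b i), fun x t t' => ?_⟩
  have h_b (z : σ ⊕ (τ ⊕ τ) → K) :
      evalMap (fun i => bind₁ (ψ Sum.inl) (b i)) z = evalMap b (evalMap (ψ Sum.inl) z) :=
    _root_.funext fun i => (aeval_evalMap _ _ _).symm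
  rw [aeval_differential, h_b, h_ψ, h_ψ, Sum.elim_comp_inl, Sum.elim_comp_inr]

namespace TangentFrame

variable {K σ : Type*} [Field K] [Fintype σ] {A : Set (σ → K)} {d : ℕ}

theorem trdeg_rulingIdeal [IsAlgClosed K] [CharZero K] [hA : (vanishingIdeal K A).IsPrime]
    (B : TangentFrame (vanishingIdeal K A) 3) (hB : B.denom ∉ vanishingIdeal K A)
    (hX : IsTangentField (vanishingIdeal K A) X) (hA₀ : 0 ∉ A) {g : MvPolynomial σ K}
    (hg : g ∉ vanishingIdeal K A)
    (h_finrank : ∀ x ∈ A, aeval x g ≠ 0 →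
      Module.finrank K (secondSpan (vanishingIdeal K A) x) = 5) :
    Algebra.trdeg K (MvPolynomial σ K ⧸ B.rulingIdeal) = (5 : ℕ) := by
  have h_prime := isPrime_vanishingIdeal_cylinder hA (Fin 3)
  have := B.isPrime_rulingIdeal
  obtain ⟨n, hn⟩ := Cardinal.lt_aleph0.1
    (trdeg_lt_aleph0_of_finiteType (R := K) (S := MvPolynomial σ K ⧸ B.rulingIdeal))
  obtain ⟨h, hh, h_tangent⟩ := B.exists_forall_tangentAt_rulingIdeal hB hn
  obtain ⟨x, hx, t, hxt⟩ := exists_aeval_elim_ne_zero (f := rename Sum.inl g * h) fun h_mem =>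
    (h_prime.mem_or_mem h_mem).elim (mt rename_inl_mem_vanishingIdeal_cylinder.1 hg) hh
  rw [map_mul, aeval_rename, Sum.elim_comp_inl, ← aeval_bind₁_elim_C_X] at hxt
  have hxh : bind₁ (Sum.elim (C ∘ x) X) h ≠ 0 := fun h₀ =>
    right_ne_zero_of_mul hxt (by rw [h₀, map_zero])
  have hxB := (h_tangent x hx t (aeval_bind₁_elim_C_X x t h ▸ right_ne_zero_of_mul hxt)).1
  obtain ⟨s, hs, hs_finrank⟩ := B.exists_finrank_rulingTangent_eq hxB (fun f hf => hf x hx) hX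
    (ne_of_mem_of_not_mem hx hA₀) (h_finrank x hx (left_ne_zero_of_mul hxt)) hxh
  obtain ⟨-, h_eq, h_ruling⟩ := h_tangent x hx s (aeval_bind₁_elim_C_X x s h ▸ hs)
  rw [hn, ← h_eq, h_ruling, hs_finrank]

theorem exists_forall_tangentAt_rulingIdeal_eq_secondSpan [CharZero K]
    [hA : (vanishingIdeal K A).IsPrime] (B : TangentFrame (vanishingIdeal K A) d)
    (hB : B.denom ∉ vanishingIdeal K A) {n : ℕ}
    (hn : Algebra.trdeg K (MvPolynomial σ K ⧸ B.rulingIdeal) = n) {g : MvPolynomial σ K}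
    (hg : g ∉ vanishingIdeal K A)
    (h_finrank : ∀ x ∈ A, aeval x g ≠ 0 →
      Module.finrank K (secondSpan (vanishingIdeal K A) x) = n) :
    ∃ h ∉ vanishingIdeal K (cylinder A (Fin d)), ∀ x ∈ A, ∀ t, aeval (Sum.elim x t) h ≠ 0 →
      tangentAt B.rulingIdeal (evalMap B.rulingMap (Sum.elim x t)) =
        secondSpan (vanishingIdeal K A) x := by
  have h_infinite := CharZero.infinite K
  have h_prime := isPrime_vanishingIdeal_cylinder hA (Fin d)
  obtain ⟨h, hh, h_tangent⟩ := B.exists_forall_tangentAt_rulingIdeal hB hn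
  refine ⟨rename Sum.inl g * h, fun h_mem => (h_prime.mem_or_mem h_mem).elim
    (mt rename_inl_mem_vanishingIdeal_cylinder.1 hg) hh, fun x hx t hxt => ?_⟩
  rw [map_mul, aeval_rename, Sum.elim_comp_inl] at hxt
  obtain ⟨-, h_eq, h_ruling⟩ := h_tangent x hx t (right_ne_zero_of_mul hxt)
  rw [h_ruling] at h_eq ⊢
  exact Submodule.eq_of_le_of_finrank_eq
    (rulingTangent_le_secondSpan (B.evalMap_rulingMap_mem (fun f hf => hf x hx) t))
    (h_eq.trans (h_finrank x hx (left_ne_zero_of_mul hxt)).symm)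

theorem tangentAt_rulingIdeal_le [CharZero K] [hA : (vanishingIdeal K A).IsPrime]
    (B : TangentFrame (vanishingIdeal K A) d) {n : ℕ}
    (hn : Algebra.trdeg K (MvPolynomial σ K ⧸ B.rulingIdeal) = n)
    {T : (σ → K) → Submodule K (σ → K)} {h : MvPolynomial (σ ⊕ Fin d) K}
    (hh : h ∉ vanishingIdeal K (cylinder A (Fin d)))
    (h_tangent : ∀ x ∈ A, ∀ t, aeval (Sum.elim x t) h ≠ 0 →
      tangentAt B.rulingIdeal (evalMap B.rulingMap (Sum.elim x t)) = T x)
    {x : σ → K} (hx : x ∈ A) {t : Fin d → K}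
    (h_finrank : Module.finrank K
      (tangentAt B.rulingIdeal (evalMap B.rulingMap (Sum.elim x t))) = n) (t' : Fin d → K) :
    tangentAt B.rulingIdeal (evalMap B.rulingMap (Sum.elim x t)) ≤
      tangentAt B.rulingIdeal (evalMap B.rulingMap (Sum.elim x t')) := by
  have h_infinite := CharZero.infinite K
  have h_prime := isPrime_vanishingIdeal_cylinder hA (Fin d ⊕ Fin d)
  have := B.isPrime_rulingIdeal
  obtain ⟨B', hB'⟩ := exists_tangentFrame hn (B.aeval_rulingMap_eq_zero hx t) h_finrank
  rw [B'.tangentAt_eq_span hB' (B.aeval_rulingMap_eq_zero hx t), Submodule.span_le]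
  rintro _ ⟨j, rfl⟩
  refine mem_tangentAt.2 fun f hf => ?_
  obtain ⟨D, hD⟩ := exists_aeval_elim_eq_differential B.rulingMap f (B'.field j)
  have h_vanish : D ∈ vanishingIdeal K (cylinder A (Fin d ⊕ Fin d)) := by
    refine mem_vanishingIdeal_cylinder_of_forall_ne_zero
      (h := rename (Sum.map id Sum.inl) h * rename (Sum.map id Sum.inr) h)
      (fun h_mem => (h_prime.mem_or_mem h_mem).elim
        (mt (rename_map_id_mem_vanishingIdeal_cylinder Sum.inl_injective).1 hh)
        (mt (rename_map_id_mem_vanishingIdeal_cylinder Sum.inr_injective).1 hh))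
      fun y hy s hs => ?_
    rw [← Sum.elim_comp_inl_inr s] at hs ⊢
    rw [map_mul, aeval_rename, aeval_rename, Sum.elim_comp_map, Sum.elim_comp_map,
      Sum.elim_comp_inl, Sum.elim_comp_inr] at hs
    have h_mem := (B'.isTangentField j).evalMap_mem_tangentAt
      (B.aeval_rulingMap_eq_zero hy (s ∘ Sum.inl))
    rw [h_tangent y hy _ (left_ne_zero_of_mul hs),
      ← h_tangent y hy _ (right_ne_zero_of_mul hs)] at h_mem
    rw [hD]
    exact mem_tangentAt.1 h_mem f hf
  rw [← hD]
  exact mem_vanishingIdeal_cylinder.1 h_vanish x hx (Sum.elim t t')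

end TangentFrame

theorem TangentFrame.secondSpan_le_of_forall_rulingTangent_le {K σ : Type*} [Field K] [Infinite K]
    [Fintype σ] {P : Ideal (MvPolynomial σ K)} {d : ℕ} (B : TangentFrame P d) {x : σ → K}
    (hB : aeval x B.denom ≠ 0) (hx : ∀ f ∈ P, aeval x f = 0) {W : Submodule K (σ → K)}
    {g : MvPolynomial (Fin d) K} (hg : g ≠ 0)
    (hW : ∀ t, eval t g ≠ 0 → rulingTangent P x (evalMap B.rulingMap (Sum.elim x t)) ≤ W) :
    secondSpan P x ≤ W := by
  obtain ⟨t, ht⟩ := exists_eval_ne_zero hg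
  have h_ker : LinearMap.ker (conormalMap P x) ≤ W :=
    ker_conormalMap.trans_le ((tangentAt_le_rulingTangent _).trans (hW t ht))
  rw [secondSpan, ← Submodule.comap_map_eq_self h_ker]
  refine Submodule.comap_mono (Submodule.map₂_le.2 fun v hv w hw => ?_)
  suffices h_top : ((W.map (conormalMap P x)).comap ((hessianMap P x).flip w)).comap
      (tangentAt P x).subtype = ⊤ from h_top.ge (Submodule.mem_top (x := ⟨v, hv⟩))
  refine eq_top_of_forall_eval_ne_zero_sum_smul_mem (B.basis hB hx) hg fun t ht => ?_
  have h_mem := B.evalMap_rulingMap_mem hx t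
  rw [Submodule.mem_comap, Submodule.subtype_apply, B.coe_sum_smul_basis hB hx, Submodule.mem_comap,
    LinearMap.flip_apply]
  obtain ⟨u, hu⟩ :=
    B.map₂_hessianMap_le_range hB hx (Submodule.apply_mem_map₂ (hessianMap P x) h_mem hw)
  exact ⟨u, hW t ht ⟨w, hw, hu.symm⟩, hu⟩

section NonsingularPoint

variable {K : Type*} [Field K] {N d : ℕ} {A : Set (PSpace K N)} {p q : PSpace K N}
  {x v : Fin (N + 1) → K}

theorem isNonsingularPoint_iff (hd : HasDim A d) :
    IsNonsingularPoint A p ↔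
      p ∈ A ∧ Module.finrank K (tangentAt (idealOf A) p.rep) = d + 1 := by
  unfold HasDim at hd
  rw [IsNonsingularPoint, hd, tangentSpace_eq_tangentAt, ← Module.finrank_eq_rank]
  norm_cast

theorem isNonsingularPoint_mk_iff (hd : HasDim A d) (hx : x ≠ 0) :
    IsNonsingularPoint A (Projectivization.mk K x hx) ↔
      Projectivization.mk K x hx ∈ A ∧ Module.finrank K (tangentAt (idealOf A) x) = d + 1 := by
  rw [isNonsingularPoint_iff hd, ← tangentSpace_eq_tangentAt, tangentSpace_mk]

theorem IsNonsingularPoint.exists_tangentFrame [CharZero K] (hA : (idealOf A).IsPrime)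
    (hd : HasDim A d) (hp : IsNonsingularPoint A p) :
    ∃ B : TangentFrame (idealOf A) (d + 1), aeval p.rep B.denom ≠ 0 := by
  rw [isNonsingularPoint_iff hd] at hp
  exact ProjSurf.exists_tangentFrame hd (fun _ hf => hf _ (rep_mem_affineCone hp.1)) hp.2

theorem TangentFrame.isNonsingularPoint_mk
    (B : TangentFrame (vanishingIdeal K (affineCone A)) (d + 1)) (hd : HasDim A d)
    (hx : x ∈ affineCone A) (hB : aeval x B.denom ≠ 0) :
    IsNonsingularPoint A (Projectivization.mk K x hx.1) :=
  (isNonsingularPoint_mk_iff hd hx.1).2 ⟨hx.2, B.finrank_tangentAt hB fun _ hf => hf x hx⟩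

theorem mk_mem_embeddedTangentSpace (hv : v ≠ 0) :
    Projectivization.mk K v hv ∈ embeddedTangentSpace A p ↔ v ∈ tangentSpace A p := by
  change (Projectivization.mk K v hv).submodule ≤ _ ↔ _
  rw [Projectivization.submodule_mk, Submodule.span_singleton_le_iff_mem]

theorem rep_mem_tangentSpace :
    q.rep ∈ tangentSpace A p ↔ q ∈ embeddedTangentSpace A p := by
  rw [← mk_mem_embeddedTangentSpace q.rep_nonzero, q.mk_rep]

theorem embeddedTangentSpace_eq_iff :
    embeddedTangentSpace A p = embeddedTangentSpace A q ↔ tangentSpace A p = tangentSpace A q := by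
  refine ⟨fun h => ?_, fun h => by rw [embeddedTangentSpace, h, embeddedTangentSpace]⟩
  ext v
  obtain rfl | hv := eq_or_ne v 0
  · simp only [zero_mem]
  · rw [← mk_mem_embeddedTangentSpace hv, h, mk_mem_embeddedTangentSpace hv]

theorem TangentFrame.mk_evalMap_rulingMap_mem
    (B : TangentFrame (vanishingIdeal K (affineCone A)) d) (hx : x ∈ affineCone A) (t : Fin d → K)
    (ht : evalMap B.rulingMap (Sum.elim x t) ≠ 0) :
    Projectivization.mk K _ ht ∈ embeddedTangentSpace A (Projectivization.mk K x hx.1) := by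
  rw [mk_mem_embeddedTangentSpace, tangentSpace_mk]
  exact B.evalMap_rulingMap_mem (fun _ hf => hf x hx) t

theorem subset_zariskiClosure (A : Set (PSpace K N)) : A ⊆ zariskiClosure A :=
  fun _ hp _ hf => hf _ (rep_mem_affineCone hp)

theorem idealOf_zariskiClosure [Infinite K] (A : Set (PSpace K N)) :
    idealOf (zariskiClosure A) = idealOf A := by
  refine le_antisymm (fun f hf x hx => hf x ⟨hx.1, subset_zariskiClosure A hx.2⟩) ?_
  rintro f hf x ⟨hx, hxA⟩
  obtain ⟨a, ha, h_rep⟩ := exists_mk_rep_eq_smul (K := K) hx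
  change eval x f = 0
  rw [← sum_homogeneousComponent f, map_sum]
  refine Finset.sum_eq_zero fun n _ => ?_
  have h_zero := hxA _ (homogeneousComponent_mem_idealOf hf n)
  rw [h_rep, eval_smul_of_isHomogeneous (homogeneousComponent_isHomogeneous n f)] at h_zero
  exact (mul_eq_zero.1 h_zero).resolve_left (pow_ne_zero _ ha)

theorem isZariskiClosed_zariskiClosure [Infinite K] (A : Set (PSpace K N)) :
    IsZariskiClosed (zariskiClosure A) := by
  refine ⟨{f | f ∈ idealOf A ∧ ∃ n, f.IsHomogeneous n}, fun f hf => hf.2,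
    Set.Subset.antisymm (fun p hp f hf => hp f hf.1) fun p hp f hf => ?_⟩
  rw [← sum_homogeneousComponent f, map_sum]
  exact Finset.sum_eq_zero fun n _ => hp _
    ⟨homogeneousComponent_mem_idealOf hf n, n, homogeneousComponent_isHomogeneous n f⟩

theorem subset_tangentVariety (hp : IsNonsingularPoint A p) :
    embeddedTangentSpace A p ⊆ tangentVariety A :=
  fun _ hq => subset_zariskiClosure _ ⟨p, hp, hq⟩

theorem idealOf_tangentVariety_le [Infinite K] (hA : (idealOf A).IsPrime) (hd : HasDim A d)
    (B : TangentFrame (vanishingIdeal K (affineCone A)) (d + 1)) (hB : B.denom ∉ idealOf A) :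
    idealOf (tangentVariety A) ≤ B.rulingIdeal := by
  have : (vanishingIdeal K (affineCone A)).IsPrime := hA
  have h_prime := isPrime_vanishingIdeal_cylinder this (Fin (d + 1))
  intro f hf
  refine mem_vanishingIdeal_cylinder_of_forall_ne_zero (h := rename Sum.inl B.denom * X (Sum.inr 0))
    (fun h_mem => (h_prime.mem_or_mem h_mem).elim
      (mt rename_inl_mem_vanishingIdeal_cylinder.1 hB)
      (X_inr_notMem_vanishingIdeal_cylinder this 0)) fun x hx t hxt => ?_
  rw [map_mul, aeval_rename, Sum.elim_comp_inl, aeval_X, Sum.elim_inr] at hxt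
  have hxB := left_ne_zero_of_mul hxt
  have ht : t ≠ 0 := fun h_zero => right_ne_zero_of_mul hxt (congrFun h_zero 0)
  have h_ne := B.evalMap_rulingMap_ne_zero hxB ht
  rw [← aeval_evalMap]
  exact hf _ ⟨h_ne, subset_tangentVariety (B.isNonsingularPoint_mk hd hx hxB)
    (B.mk_evalMap_rulingMap_mem hx t h_ne)⟩

theorem idealOf_tangentVariety [CharZero K] (hA : (idealOf A).IsPrime) (hd : HasDim A d)
    (B : TangentFrame (vanishingIdeal K (affineCone A)) (d + 1)) (hB : B.denom ∉ idealOf A) :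
    idealOf (tangentVariety A) = B.rulingIdeal := by
  have h_infinite := CharZero.infinite K
  have : (vanishingIdeal K (affineCone A)).IsPrime := hA
  refine le_antisymm (idealOf_tangentVariety_le hA hd B hB) ?_
  rw [tangentVariety, idealOf_zariskiClosure]
  rintro f hf v ⟨hv, p, hp, hvp⟩
  rw [mk_mem_embeddedTangentSpace, tangentSpace_eq_tangentAt] at hvp
  obtain ⟨B', hB'⟩ := hp.exists_tangentFrame hA hd
  obtain ⟨t, rfl⟩ := B'.exists_evalMap_rulingMap_eq hB' hvp
  exact TangentFrame.aeval_rulingMap_eq_zero B' (rep_mem_affineCone hp.1) t f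
    (B.rulingIdeal_le hB B' hf)

end NonsingularPoint

section PhiSurface

variable {K : Type*} [Field K] {N : ℕ} {S : Set (PSpace K N)}

theorem isPhiSurface_iff_hasUniqueConjugatePair [IsAlgClosed K] [CharZero K]
    (hS : (idealOf S).IsPrime) (hd : HasDim S 2) :
    IsPhiSurface S ↔ HasUniqueConjugatePair S := by
  refine exists_congr fun U => and_congr_right fun _ => and_congr_right fun _ =>
    forall₂_congr fun p _ => and_congr_right fun hp => ?_
  obtain ⟨B, hB⟩ := hp.exists_tangentFrame hS hd
  exact (B.existsUnique_isConjugatePair_iff hp.1 hB).symm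

theorem IsPhiSurface.exists_forall_finrank_secondSpan [CharZero K] (hΦ : IsPhiSurface S)
    (hS : (idealOf S).IsPrime) (hd : HasDim S 2) :
    ∃ g ∉ idealOf S, ∀ x ∈ affineCone S, aeval x g ≠ 0 →
      Module.finrank K (secondSpan (idealOf S) x) = 5 := by
  have : (vanishingIdeal K (affineCone S)).IsPrime := hS
  obtain ⟨B, hB⟩ := exists_tangentFrame_denom_notMem hd
  obtain ⟨g, hg, h_finrank⟩ := exists_forall_affineCone_of_atGeneralPoint hΦ
  refine ⟨g * B.denom, fun h_mem => (hS.mem_or_mem h_mem).elim hg hB, fun x hx hgx => ?_⟩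
  rw [map_mul] at hgx
  rw [← osculatingSpace_mk B hx (right_ne_zero_of_mul hgx) hx.1]
  exact (h_finrank x hx (left_ne_zero_of_mul hgx) hx.1).2

theorem IsPhiSurface.trdeg_rulingIdeal [IsAlgClosed K] [CharZero K] (hΦ : IsPhiSurface S)
    (hS : (idealOf S).IsPrime) (hd : HasDim S 2)
    (B : TangentFrame (vanishingIdeal K (affineCone S)) 3) (hB : B.denom ∉ idealOf S) :
    Algebra.trdeg K (MvPolynomial (Fin (N + 1)) K ⧸ B.rulingIdeal) = (5 : ℕ) := by
  have : (vanishingIdeal K (affineCone S)).IsPrime := hS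
  have h_infinite := CharZero.infinite K
  obtain ⟨g, hg, h_finrank⟩ := hΦ.exists_forall_finrank_secondSpan hS hd
  exact B.trdeg_rulingIdeal hB (isTangentField_X S) (fun h_zero => h_zero.1 rfl) hg h_finrank

theorem IsPhiSurface.hasDim_tangentVariety [IsAlgClosed K] [CharZero K] (hΦ : IsPhiSurface S)
    (hS : (idealOf S).IsPrime) (hd : HasDim S 2) : HasDim (tangentVariety S) 4 := by
  have : (vanishingIdeal K (affineCone S)).IsPrime := hS
  obtain ⟨B, hB⟩ := exists_tangentFrame_denom_notMem hd
  unfold HasDim CoordRing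
  rw [idealOf_tangentVariety hS hd B hB]
  exact hΦ.trdeg_rulingIdeal hS hd B hB

theorem isProjVariety_tangentVariety [CharZero K] {d : ℕ} (hS : (idealOf S).IsPrime)
    (hd : HasDim S d) : IsProjVariety (tangentVariety S) := by
  have : (vanishingIdeal K (affineCone S)).IsPrime := hS
  have h_infinite := CharZero.infinite K
  obtain ⟨B, hB⟩ := exists_tangentFrame_denom_notMem hd
  refine ⟨isZariskiClosed_zariskiClosure _, ?_⟩
  rw [idealOf_tangentVariety hS hd B hB]
  exact B.isPrime_rulingIdeal

theorem IsPhiSurface.tangentSpace_tangentVariety_le [IsAlgClosed K] [CharZero K]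
    (hΦ : IsPhiSurface S) (hS : (idealOf S).IsPrime) (hd : HasDim S 2) {p q q' : PSpace K N}
    (hp : IsNonsingularPoint S p) (hq : q ∈ embeddedTangentSpace S p)
    (hq' : q' ∈ embeddedTangentSpace S p) (hqV : IsNonsingularPoint (tangentVariety S) q) :
    tangentSpace (tangentVariety S) q ≤ tangentSpace (tangentVariety S) q' := by
  have : (vanishingIdeal K (affineCone S)).IsPrime := hS
  obtain ⟨B, hBp⟩ : ∃ B : TangentFrame (vanishingIdeal K (affineCone S)) 3,
    aeval p.rep B.denom ≠ 0 := hp.exists_tangentFrame hS hd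
  have hB : B.denom ∉ idealOf S := fun h_mem => hBp (h_mem _ (rep_mem_affineCone hp.1))
  have hn := hΦ.trdeg_rulingIdeal hS hd B hB
  obtain ⟨g, hg, h_finrank⟩ := hΦ.exists_forall_finrank_secondSpan hS hd
  obtain ⟨h, hh, h_tangent⟩ :=
    B.exists_forall_tangentAt_rulingIdeal_eq_secondSpan hB hn hg h_finrank
  rw [← rep_mem_tangentSpace, tangentSpace_eq_tangentAt] at hq hq'
  obtain ⟨t, ht⟩ := B.exists_evalMap_rulingMap_eq hBp hq
  obtain ⟨t', ht'⟩ := B.exists_evalMap_rulingMap_eq hBp hq'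
  rw [isNonsingularPoint_iff (hΦ.hasDim_tangentVariety hS hd),
    idealOf_tangentVariety hS hd B hB, ← ht] at hqV
  rw [tangentSpace_eq_tangentAt, tangentSpace_eq_tangentAt, idealOf_tangentVariety hS hd B hB,
    ← ht, ← ht']
  exact B.tangentAt_rulingIdeal_le hn hh h_tangent (rep_mem_affineCone hp.1) hqV.2 t'

theorem IsPhiSurface.tangentVarietyIsFourfoldWithFixedTangent [IsAlgClosed K] [CharZero K]
    (hΦ : IsPhiSurface S) (hS : (idealOf S).IsPrime) (hd : HasDim S 2) :
    TangentVarietyIsFourfoldWithFixedTangent S := by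
  refine ⟨isProjVariety_tangentVariety hS hd, hΦ.hasDim_tangentVariety hS hd,
    fun p hp q hq q' hq' hqV hqV' => embeddedTangentSpace_eq_iff.2 (le_antisymm ?_ ?_)⟩
  · exact hΦ.tangentSpace_tangentVariety_le hS hd hp hq hq' hqV
  · exact hΦ.tangentSpace_tangentVariety_le hS hd hp hq' hq hqV'

end PhiSurface

section FixedTangent

variable {K : Type*} [Field K] {N d n : ℕ} {A : Set (PSpace K N)}

theorem exists_forall_tangentSpace_tangentVariety [CharZero K] (hA : (idealOf A).IsPrime)
    (hd : HasDim A d) (B : TangentFrame (vanishingIdeal K (affineCone A)) (d + 1))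
    (hB : B.denom ∉ idealOf A) (hV : HasDim (tangentVariety A) n) :
    ∃ h ∉ vanishingIdeal K (cylinder (affineCone A) (Fin (d + 1))), ∀ x (hx : x ∈ affineCone A),
      ∀ t, aeval (Sum.elim x t) h ≠ 0 → aeval x B.denom ≠ 0 ∧
      ∃ q ∈ embeddedTangentSpace A (Projectivization.mk K x hx.1),
        IsNonsingularPoint (tangentVariety A) q ∧
        tangentSpace (tangentVariety A) q =
          rulingTangent (vanishingIdeal K (affineCone A)) x
            (evalMap B.rulingMap (Sum.elim x t)) := by
  have h_infinite := CharZero.infinite K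
  have : (vanishingIdeal K (affineCone A)).IsPrime := hA
  have h_ideal := idealOf_tangentVariety hA hd B hB
  have hn : Algebra.trdeg K (MvPolynomial (Fin (N + 1)) K ⧸ B.rulingIdeal) = (n + 1 : ℕ) := by
    rw [← h_ideal]
    exact hV
  obtain ⟨h, hh, h_tangent⟩ := B.exists_forall_tangentAt_rulingIdeal hB hn
  have h_prime := isPrime_vanishingIdeal_cylinder this (Fin (d + 1))
  refine ⟨h * X (Sum.inr 0), fun h_mem => (h_prime.mem_or_mem h_mem).elim hh
    (X_inr_notMem_vanishingIdeal_cylinder this 0), fun x hx t hxt => ?_⟩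
  rw [map_mul, aeval_X, Sum.elim_inr] at hxt
  obtain ⟨hxB, h_finrank, h_eq⟩ := h_tangent x hx t (left_ne_zero_of_mul hxt)
  have ht : t ≠ 0 := fun h_zero => right_ne_zero_of_mul hxt (congrFun h_zero 0)
  have h_ne := B.evalMap_rulingMap_ne_zero hxB ht
  have h_mem := B.mk_evalMap_rulingMap_mem hx t h_ne
  refine ⟨hxB, _, h_mem, ?_, ?_⟩
  · rw [isNonsingularPoint_mk_iff hV, h_ideal]
    exact ⟨subset_tangentVariety (B.isNonsingularPoint_mk hd hx hxB) h_mem,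
      h_finrank⟩
  · rw [tangentSpace_mk, h_ideal, h_eq]

theorem atGeneralPoint_finrank_osculatingSpace_eq [CharZero K] (hA : (idealOf A).IsPrime)
    (hd : HasDim A d) (hV : HasDim (tangentVariety A) n)
    (h_fixed : ∀ p, IsNonsingularPoint A p →
      ∀ q ∈ embeddedTangentSpace A p, ∀ q' ∈ embeddedTangentSpace A p,
        IsNonsingularPoint (tangentVariety A) q → IsNonsingularPoint (tangentVariety A) q' →
          embeddedTangentSpace (tangentVariety A) q = embeddedTangentSpace (tangentVariety A) q') :
    AtGeneralPoint A fun p => IsNonsingularPoint A p ∧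
      Module.finrank K (osculatingSpace 2 A p) = n + 1 := by
  have h_infinite := CharZero.infinite K
  have : (vanishingIdeal K (affineCone A)).IsPrime := hA
  obtain ⟨B, hB⟩ := exists_tangentFrame_denom_notMem hd
  obtain ⟨h, hh, h_tangent⟩ := exists_forall_tangentSpace_tangentVariety hA hd B hB hV
  obtain ⟨x₀, hx₀, t₀, h_ne⟩ := exists_aeval_elim_ne_zero hh
  refine atGeneralPoint_of_forall_affineCone (g := bind₁ (Sum.elim X (C ∘ t₀)) h)
    (fun h_mem => h_ne ((aeval_bind₁_elim_X_C x₀ t₀ h).symm.trans (h_mem x₀ hx₀)))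
    fun x hx hxt _ => ?_
  rw [aeval_bind₁_elim_X_C] at hxt
  obtain ⟨hxB, q, hq, hqV, h_eq⟩ := h_tangent x hx t₀ hxt
  have hp := B.isNonsingularPoint_mk hd hx hxB
  have hxA : ∀ f ∈ vanishingIdeal K (affineCone A), aeval x f = 0 := fun f hf => hf x hx
  have h_second : secondSpan (vanishingIdeal K (affineCone A)) x =
      tangentSpace (tangentVariety A) q := by
    have h_nonzero : bind₁ (Sum.elim (C ∘ x) X) h ≠ 0 := fun h_zero => hxt <| by
      rw [← aeval_bind₁_elim_C_X, h_zero, map_zero]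
    refine le_antisymm (B.secondSpan_le_of_forall_rulingTangent_le hxB hxA h_nonzero
      fun t ht => ?_) (h_eq.trans_le (rulingTangent_le_secondSpan (B.evalMap_rulingMap_mem hxA t₀)))
    obtain ⟨-, q', hq', hqV', h_eq'⟩ := h_tangent x hx t (by rwa [← aeval_bind₁_elim_C_X])
    rw [← h_eq', embeddedTangentSpace_eq_iff.1 (h_fixed _ hp q' hq' q hq hqV' hqV)]
  refine ⟨hp, ?_⟩
  rw [osculatingSpace_mk B hx hxB, idealOf, h_second, tangentSpace_eq_tangentAt]
  exact ((isNonsingularPoint_iff hV).1 hqV).2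

end FixedTangent

end ProjSurf

theorem mainTheorem9_general {K : Type*} [Field K] [IsAlgClosed K] [CharZero K] {N : ℕ}
    {S : Set (ProjSurf.PSpace K N)} (hS : (ProjSurf.idealOf S).IsPrime)
    (hdim : ProjSurf.HasDim S 2) :
    List.TFAE [ProjSurf.IsPhiSurface S,
      ProjSurf.HasUniqueConjugatePair S,
      ProjSurf.TangentVarietyIsFourfoldWithFixedTangent S] := by
  tfae_have 1 ↔ 2 := ProjSurf.isPhiSurface_iff_hasUniqueConjugatePair hS hdim
  tfae_have 1 → 3 := fun hΦ => hΦ.tangentVarietyIsFourfoldWithFixedTangent hS hdim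
  tfae_have 3 → 1 := fun ⟨_, hV, h_fixed⟩ =>
    ProjSurf.atGeneralPoint_finrank_osculatingSpace_eq hS hdim hV h_fixed
  tfae_finish

theorem mainTheorem9 {K : Type*} [Field K] [IsAlgClosed K] [CharZero K] (N : ℕ) (hN : 5 ≤ N)
    (S : Set (ProjSurf.PSpace K N)) (hS : ProjSurf.IsProjVariety S) (hdim : ProjSurf.HasDim S 2) :
    List.TFAE [ProjSurf.IsPhiSurface S,
      ProjSurf.HasUniqueConjugatePair S,
      ProjSurf.TangentVarietyIsFourfoldWithFixedTangent S] :=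
  mainTheorem9_general hS.prime hdim
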